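/- Let $T>0$, $s\ge 0$, and let $q\in L^\infty(0,1)$ be real-valued. Let $\mathcal L=-\frac{d^2}{dx^2}+q$ on $L^2(0,1)=L^2((0,1);\mathbb C)$ with Dirichlet boundary conditions, with eigenvalues $\lambda_k$ and a corresponding orthonormal basis of eigenfunctions $\phi_k$, $k\ge1$, and assume that all $\lambda_k$ are positive. For $r\ge 0$ let $\mathcal L^r f=\sum_k\lambda_k^r\langle f,\phi_k\rangle\phi_k$ on the set of all $f\in L^2(0,1)$ for which the series converges in $L^2(0,1)$, and let $W^s_{\mathcal L}$ be the domain of $\mathcal L^{s/2}$ with the norm $\|f\|_{W^s_{\mathcal L}}=\|\mathcal L^{s/2}f\|_{L^2}$. For a normed space $X$, a net $(f_\varepsilon)_{\varepsilon\in(0,1]}$ in $X$ is called $X$-moderate if there are $N\in\mathbb N_0$ and $C>0$ with $\|f_\varepsilon\|_X\le C\varepsilon^{-N}$ for all $\varepsilon\in(0,1]$. A net of functions on $(0,1)$ is a regularisation of a distribution $A\in\mathcal D'(0,1)$ if it converges to $A$ in the sense of distributions as $\varepsilon\to0^+$. A net $(u_\varepsilon)_{\varepsilon\in(0,1]}$ in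 $C([0,T];W^s_{\mathcal L})\cap C^1([0,T];L^2(0,1))$ is uniformly $s$-moderate if there are $N\in\mathbb N_0$ and $C>0$ with $$\sup_{t\in[0,T]}\Big(\|u_\varepsilon(t)\|_{L^2}+\|\mathcal L^{s/2}u_\varepsilon(t)\|_{L^2}+\|\partial_tu_\varepsilon(t)\|_{L^2}\Big)\le C\varepsilon^{-N}\qquad\text{for all }\varepsilon\in(0,1].$$ **Theorem (Existence).** Let $a,b,u_0,u_1\in\mathcal D'(0,1)$ with $a,b$ non-negative. Let $(a_\varepsilon)$ and $(b_\varepsilon)$ be non-negative $L^\infty(0,1)$-moderate regularisations of $a$ and $b$, let $(u_{0,\varepsilon})$ be a $W^s_{\mathcal L}$-moderate regularisation of $u_0$, and let $(u_{1,\varepsilon})$ be an $L^2(0,1)$-moderate regularisation of $u_1$. Then there is a uniformly $s$-moderate net $(u_\varepsilon)_{\varepsilon\in(0,1]}$ in $C([0,T];W^s_{\mathcal L})\cap C^1([0,T];L^2(0,1))$ such that, for every $\varepsilon\in(0,1]$, $u_\varepsilon$ solves $$\begin{cases}\partial_t^2u_\varepsilon+\mathcal L^su_\varepsilon+a_\varepsilon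 u_\varepsilon+b_\varepsilon\,\partial_tu_\varepsilon=0 & \text{on }[0,T]\times(0,1),\\ u_\varepsilon(0,\cdot)=u_{0,\varepsilon},\quad \partial_tu_\varepsilon(0,\cdot)=u_{1,\varepsilon},\\ u_\varepsilon(t,0)=u_\varepsilon(t,1)=0,& t\in[0,T].\end{cases}$$ That is, the problem $$u_{tt}+\mathcal L^su+a\,u+b\,u_t=0,\qquad u(0,\cdot)=u_0,\quad u_t(0,\cdot)=u_1,\qquad u(t,0)=u(t,1)=0$$ has a very weak solution. Here the equation is understood in the dual of $W^s_{\mathcal L}$: for every $f\in W^s_{\mathcal L}$ the function $t\mapsto\langle\partial_tu_\varepsilon(t),f\rangle$ is differentiable on $[0,T]$ with derivative $-\langle\mathcal L^{s/2}u_\varepsilon(t),\mathcal L^{s/2}f\rangle-\langle a_\varepsilon u_\varepsilon(t)+b_\varepsilon\partial_tu_\varepsilon(t),f\rangle$. The Dirichlet conditions are those built into $\mathcal L$; if $s>\frac12$ they also hold pointwise, for the representative of $u_\varepsilon(t)$ that is continuous on $[0,1]$ (for $s\le\frac12$ elements of $W^s_{\mathcal L}$ have no boundary values in general). -/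

import Mathlib

open MeasureTheory Set Filter Topology
open scoped ENNReal Distributions

noncomputable section

namespace SturmLiouville

/-- The open unit interval as an open subset of `ℝ`. -/
def unitOpen : TopologicalSpace.Opens ℝ := ⟨Ioo 0 1, isOpen_Ioo⟩

/-- Lebesgue measure on `(0,1)`. -/
abbrev mu : Measure ℝ := volume.restrict (Ioo (0 : ℝ) 1)

/-- The complex Hilbert space `L²(0,1)`. -/
abbrev L2 : Type := Lp ℂ 2 mu

/-- The space of real functions `L^∞(0,1)`. -/
abbrev LInf : Type := Lp ℝ ∞ mu

/-! ### The Sturm-Liouville operator and its powers -/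

/-- `f ∈ Dom(𝓛)` and `𝓛 f = g`, where `𝓛 = -d²/dx² + q` with Dirichlet conditions on `(0,1)`:
`f` has a `C¹` representative `F` on `[0,1]` with `F(0) = F(1) = 0`, whose derivative `D` is
absolutely continuous with `D' = q F - g` almost everywhere (written as an integral). -/
def IsDirichletSL (q : ℝ → ℝ) (f g : L2) : Prop :=
  ∃ F D : ℝ → ℂ, f =ᵐ[mu] F ∧
    (∀ x ∈ Icc (0 : ℝ) 1, HasDerivWithinAt F (D x) (Icc 0 1) x) ∧
    (∀ x ∈ Icc (0 : ℝ) 1, D x = D 0 + ∫ t in (0 : ℝ)..x, ((q t : ℂ) * F t - g t)) ∧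
    F 0 = 0 ∧ F 1 = 0

/-- `lam` is a Dirichlet eigenvalue of `𝓛 = -d²/dx² + q` with eigenfunction `phi`
(the operator is symmetric, so that all its eigenvalues are real). -/
def IsEigenpair (q : ℝ → ℝ) (lam : ℝ) (phi : L2) : Prop :=
  phi ≠ 0 ∧ IsDirichletSL q phi ((lam : ℂ) • phi)

/-- `f ∈ Dom(𝓛^r)` and `𝓛^r f = g` in `L²(0,1)`. The eigenfunctions `φ_k` of `𝓛` are an orthogonal
basis of `L²(0,1)`, so that an element of `L²(0,1)` is determined by its coefficients; `𝓛^r` is the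
operator that multiplies the coefficient along an eigenfunction with eigenvalue `λ` by `λ^r`, on
its maximal domain. It is used for potentials with positive eigenvalues only. -/
def IsFracPow (q : ℝ → ℝ) (r : ℝ) (f g : L2) : Prop :=
  ∀ (lam : ℝ) (phi : L2), IsEigenpair q lam phi →
    inner ℂ phi g = ((lam ^ r : ℝ) : ℂ) * inner ℂ phi f

/-! ### Moderate nets and regularisations

A net is a family indexed by `ε`, of which only the members with `ε ∈ (0,1]` matter. -/

/-- `‖f_ε‖ ≲ ε^{-N}` for some `N`, for a net of norms. -/
def IsModerate (n : ℝ → ℝ) : Prop :=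
  ∃ (N : ℕ) (C : ℝ), 0 < C ∧ ∀ ε ∈ Ioc (0 : ℝ) 1, n ε ≤ C * (ε ^ N)⁻¹

/-- The net `f` consists of elements of `W^s_𝓛(0,1)` and is `W^s_𝓛`-moderate, with respect to the
norm `‖f‖_{W^s_𝓛} = ‖𝓛^{s/2} f‖_{L²}`. -/
def IsSobolevModerate (q : ℝ → ℝ) (s : ℝ) (f : ℝ → L2) : Prop :=
  ∃ g : ℝ → L2, (∀ ε ∈ Ioc (0 : ℝ) 1, IsFracPow q (s / 2) (f ε) (g ε)) ∧
    IsModerate (fun ε => ‖g ε‖)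

/-- The net of functions `f` on `(0,1)` is a regularisation of the distribution `A` on `(0,1)`:
`f_ε → A` in the sense of distributions as `ε → 0⁺`. -/
def IsRegularisation {F : Type} [NormedAddCommGroup F] [NormedSpace ℝ F]
    (f : ℝ → ℝ → F) (A : 𝓓'(unitOpen, F)) : Prop :=
  ∀ φ : 𝓓(unitOpen, ℝ), Tendsto (fun ε => ∫ x, φ x • f ε x ∂mu) (𝓝[>] 0) (𝓝 (A φ))

/-- A real distribution is non-negative if it is so on non-negative test functions. -/
def IsNonnegDistribution (A : 𝓓'(unitOpen, ℝ)) : Prop :=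
  ∀ φ : 𝓓(unitOpen, ℝ), (∀ x, 0 ≤ φ x) → 0 ≤ A φ

/-- `aE`, `bE` are non-negative `L^∞`-moderate regularisations of `a`, `b`; `u0E` is a
`W^s_𝓛`-moderate regularisation of `u0`, and `u1E` an `L²`-moderate regularisation of `u1`. -/
structure ModerateRegularisations (q : ℝ → ℝ) (s : ℝ) (a b : 𝓓'(unitOpen, ℝ))
    (u0 u1 : 𝓓'(unitOpen, ℂ)) (aE bE : ℝ → LInf) (u0E u1E : ℝ → L2) : Prop where
  a_reg : IsRegularisation (fun ε => ⇑(aE ε)) a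
  a_nonneg : ∀ ε ∈ Ioc (0 : ℝ) 1, 0 ≤ aE ε
  a_moderate : IsModerate (fun ε => ‖aE ε‖)
  b_reg : IsRegularisation (fun ε => ⇑(bE ε)) b
  b_nonneg : ∀ ε ∈ Ioc (0 : ℝ) 1, 0 ≤ bE ε
  b_moderate : IsModerate (fun ε => ‖bE ε‖)
  u0_reg : IsRegularisation (fun ε => ⇑(u0E ε)) u0
  u0_moderate : IsSobolevModerate q s u0E
  u1_reg : IsRegularisation (fun ε => ⇑(u1E ε)) u1
  u1_moderate : IsModerate (fun ε => ‖u1E ε‖)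

/-! ### Solutions -/

/-- `u ∈ C([0,T]; W^s_𝓛(0,1)) ∩ C¹([0,T]; L²(0,1))`, with `∂_t u = v` and `𝓛^{s/2} u = w`. -/
structure IsInSolutionSpace (T : ℝ) (q : ℝ → ℝ) (s : ℝ) (u v w : ℝ → L2) : Prop where
  deriv : ∀ t ∈ Icc 0 T, HasDerivWithinAt u (v t) (Icc 0 T) t
  deriv_cont : ContinuousOn v (Icc 0 T)
  frac : ∀ t ∈ Icc 0 T, IsFracPow q (s / 2) (u t) (w t)
  frac_cont : ContinuousOn w (Icc 0 T)

/-- `f` has a representative that is continuous on `[0,1]` and vanishes at `0` and `1`. -/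
def VanishesAtEndpoints (f : L2) : Prop :=
  ∃ F : ℝ → ℂ, ContinuousOn F (Icc 0 1) ∧ f =ᵐ[mu] F ∧ F 0 = 0 ∧ F 1 = 0

/-- `u ∈ C([0,T]; W^s_𝓛) ∩ C¹([0,T]; L²)` solves
`u_tt + 𝓛^s u + a u + b u_t = 0`, `u(0) = u0`, `u_t(0) = u1`, `u(t,0) = u(t,1) = 0`.
The equation holds for every `t ∈ [0,T]` in the dual of `W^s_𝓛`, where
`⟨f, 𝓛^s u⟩ = ⟨𝓛^{s/2} f, 𝓛^{s/2} u⟩`. The Dirichlet conditions are those of the operator `𝓛`,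
and hold pointwise if `s > 1/2`; elements of `W^s_𝓛` have no boundary values if `s ≤ 1/2`. -/
def IsSolution (T : ℝ) (q : ℝ → ℝ) (s : ℝ) (a b : LInf) (u0 u1 : L2) (u : ℝ → L2) : Prop :=
  ∃ v w : ℝ → L2, IsInSolutionSpace T q s u v w ∧
    (∀ f g : L2, IsFracPow q (s / 2) f g → ∀ t ∈ Icc 0 T,
      HasDerivWithinAt (fun τ => inner ℂ f (v τ))
        (-(inner ℂ g (w t) + inner ℂ f (a • u t : L2) + inner ℂ f (b • v t : L2)))
        (Icc 0 T) t) ∧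
    u 0 = u0 ∧ v 0 = u1 ∧
    (1 / 2 < s → ∀ t ∈ Icc 0 T, VanishesAtEndpoints (u t))

/-- The net `u` lies in `C([0,T]; W^s_𝓛) ∩ C¹([0,T]; L²)` and is uniformly `s`-moderate:
`sup_{t ∈ [0,T]} (‖u_ε(t)‖ + ‖𝓛^{s/2} u_ε(t)‖ + ‖∂_t u_ε(t)‖) ≲ ε^{-N}` for some `N`. -/
def IsUniformlyModerate (T : ℝ) (q : ℝ → ℝ) (s : ℝ) (u : ℝ → ℝ → L2) : Prop :=
  ∃ v w : ℝ → ℝ → L2,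
    (∀ ε ∈ Ioc (0 : ℝ) 1, IsInSolutionSpace T q s (u ε) (v ε) (w ε)) ∧
    ∃ (N : ℕ) (C : ℝ), 0 < C ∧ ∀ ε ∈ Ioc (0 : ℝ) 1, ∀ t ∈ Icc 0 T,
      ‖u ε t‖ + ‖w ε t‖ + ‖v ε t‖ ≤ C * (ε ^ N)⁻¹

/-- The net `u` solves, for every `ε ∈ (0,1]`, the problem with coefficients and data
`aE ε`, `bE ε`, `u0E ε`, `u1E ε`, and is uniformly `s`-moderate. -/
def IsModerateSolutionNet (T : ℝ) (q : ℝ → ℝ) (s : ℝ) (aE bE : ℝ → LInf) (u0E u1E : ℝ → L2)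
    (u : ℝ → ℝ → L2) : Prop :=
  (∀ ε ∈ Ioc (0 : ℝ) 1, IsSolution T q s (aE ε) (bE ε) (u0E ε) (u1E ε) (u ε)) ∧
    IsUniformlyModerate T q s u

/-- The net `u` is a very weak solution of the problem with coefficients `a`, `b` and data
`u0`, `u1`. -/
def IsVeryWeakSolution (T : ℝ) (q : ℝ → ℝ) (s : ℝ) (a b : 𝓓'(unitOpen, ℝ))
    (u0 u1 : 𝓓'(unitOpen, ℂ)) (u : ℝ → ℝ → L2) : Prop :=
  ∃ (aE bE : ℝ → LInf) (u0E u1E : ℝ → L2),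
    ModerateRegularisations q s a b u0 u1 aE bE u0E u1E ∧
    IsModerateSolutionNet T q s aE bE u0E u1E u

end SturmLiouville

end

/-! For fixed `ε` this is a damped wave equation with `Ω = 𝓛^{s/2}` diagonal in an eigenbasis and
`a_ε`, `b_ε` bounded multiplication operators. Put `w = Ωu`, `v = u_t`, and rotate `(w, v)` back by
the free group: `w = cos(tΩ)p + sin(tΩ)r`, `v = cos(tΩ)r - sin(tΩ)p`. The unbounded part disappears,
and `(p, r)` solves a linear ODE with bounded coefficients, solvable on all of `[0,T]`
(`exists_damped_wave`).

Moderateness comes from the energy `‖w‖² + ‖v‖² + ⟨u, a_ε u⟩`. It does not increase because `b_ε ≥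
0`, and its last term can be dropped at time `t` because `a_ε ≥ 0`. No Gronwall factor exponential
in `‖a_ε‖` or `‖b_ε‖` appears: the bound is polynomial in the norms of `a_ε` and the data, hence
again a power of `ε⁻¹`.

The spectral input is proved from the integrated form of the Dirichlet problem. A shift of `𝓛` has a
compact, symmetric, injective inverse (`exists_resolvent`), which gives the eigenbasis. Agmon's
inequality bounds sums of eigenfunctions uniformly. This yields finitely many eigenvalues below any
level, hence a gap `δ > 0` and `‖u‖ ≤ δ^{-s/2}‖w‖`; it also yields continuity and the boundary
values for `s > 1/2`, by dyadic summation. -/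

noncomputable section

namespace SturmLiouville

/-! ### Lipschitz differential equations in a Banach space -/

/-- Global solvability of `z' = M(t, z)` on `[0,T]` for a globally Lipschitz right-hand side. -/
theorem exists_forall_hasDerivWithinAt_of_lipschitz {E : Type*} [NormedAddCommGroup E]
    [NormedSpace ℝ E] [CompleteSpace E] {M : ℝ → E → E}
    (hM : Continuous fun p : ℝ × E => M p.1 p.2) {K : ℝ}
    (hK : ∀ t x y, ‖M t x - M t y‖ ≤ K * ‖x - y‖) {T : ℝ} (hT : 0 ≤ T) (z₀ : E) :
    ∃ z : ℝ → E, Continuous z ∧ z 0 = z₀ ∧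
      ∀ t ∈ Icc 0 T, HasDerivWithinAt z (M t (z t)) (Icc 0 T) t := by
  -- The fixed point is sought for `Y(t) = e^{-κt} z(t)`. In this exponentially weighted norm the
  -- Picard map has Lipschitz constant at most `|K|/κ ≤ 1/2` whatever the length of the interval, so
  -- no gluing of short-time solutions is needed.
  set κ : ℝ := 2 * (|K| + 1) with hκ
  have hκ0 : 0 < κ := by positivity
  have hint : ∀ Y : C(Icc (0 : ℝ) T, E),
      Continuous fun τ : ℝ => M τ (Real.exp (κ * τ) • Y (projIcc 0 T hT τ)) := fun Y =>
    hM.comp (continuous_id.prodMk ((by fun_prop : Continuous fun τ : ℝ => Real.exp (κ * τ)).smul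
      (Y.continuous.comp continuous_projIcc)))
  let P : C(Icc (0 : ℝ) T, E) → ℝ → E := fun Y t =>
    z₀ + ∫ τ in (0 : ℝ)..t, M τ (Real.exp (κ * τ) • Y (projIcc 0 T hT τ))
  have hPd : ∀ Y t, HasDerivAt (P Y) (M t (Real.exp (κ * t) • Y (projIcc 0 T hT t))) t :=
    fun Y t => ((hint Y).integral_hasStrictDerivAt 0 t).hasDerivAt.const_add z₀
  have hPc : ∀ Y, Continuous (P Y) := fun Y =>
    continuous_iff_continuousAt.2 fun t => (hPd Y t).continuousAt
  let Φ : C(Icc (0 : ℝ) T, E) → C(Icc (0 : ℝ) T, E) := fun Y =>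
    ⟨fun t => Real.exp (-(κ * t)) • P Y t, by have := hPc Y; fun_prop⟩
  have hΦ : ContractingWith (1 / 2) Φ := by
    refine ⟨by norm_num, LipschitzWith.of_dist_le_mul fun Y Y' => ?_⟩
    have h0 : (0 : ℝ) ≤ ((1 / 2 : NNReal) : ℝ) * dist Y Y' := by positivity
    refine (ContinuousMap.dist_le h0).2 fun t => ?_
    have ht0 : (0 : ℝ) ≤ t := t.2.1
    have hexp : ∫ τ in (0 : ℝ)..t, Real.exp (κ * τ) = κ⁻¹ * (Real.exp (κ * t) - 1) := by
      rw [intervalIntegral.integral_comp_mul_left (fun x => Real.exp x) hκ0.ne']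
      simp
    have hb : ‖P Y t - P Y' t‖ ≤ ∫ τ in (0 : ℝ)..t, K * dist Y Y' * Real.exp (κ * τ) := by
      simp only [P, add_sub_add_left_eq_sub]
      rw [← intervalIntegral.integral_sub ((hint Y).intervalIntegrable _ _)
        ((hint Y').intervalIntegrable _ _)]
      refine intervalIntegral.norm_integral_le_of_norm_le ht0
        (Eventually.of_forall fun τ _ => ?_) (Continuous.intervalIntegrable (by fun_prop) _ _)
      refine (hK _ _ _).trans ?_
      have hKn : 0 ≤ K ∨ K < 0 := le_or_gt 0 K
      rw [← smul_sub, norm_smul, Real.norm_of_nonneg (Real.exp_pos _).le, ← dist_eq_norm]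
      rcases hKn with hKn | hKn
      · have := ContinuousMap.dist_apply_le_dist (f := Y) (g := Y') (projIcc 0 T hT τ)
        calc K * (Real.exp (κ * τ) * _) ≤ K * (Real.exp (κ * τ) * dist Y Y') := by gcongr
          _ = _ := by ring
      -- A negative Lipschitz constant forces all points of `E` to coincide.
      · have hz : ∀ x y : E, ‖x - y‖ = 0 := fun x y => by
          have h1 := (norm_nonneg _).trans (hK 0 x y)
          have h2 := norm_nonneg (x - y)
          nlinarith
        have h3 : dist Y Y' = 0 := le_antisymm
          ((ContinuousMap.dist_le le_rfl).2 fun x => by rw [dist_eq_norm, hz]) dist_nonneg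
        rw [dist_eq_norm, hz, h3]; simp
    rw [intervalIntegral.integral_const_mul, hexp] at hb
    change dist (Real.exp (-(κ * t)) • P Y t) (Real.exp (-(κ * t)) • P Y' t) ≤ _
    rw [dist_eq_norm, ← smul_sub, norm_smul, Real.norm_of_nonneg (Real.exp_pos _).le]
    have hd : 0 ≤ dist Y Y' := dist_nonneg
    calc Real.exp (-(κ * t)) * ‖P Y t - P Y' t‖
        ≤ Real.exp (-(κ * t)) * (|K| * dist Y Y' * (κ⁻¹ * (Real.exp (κ * t)))) := by
          gcongr
          refine hb.trans ?_
          have : 0 ≤ κ⁻¹ * (Real.exp (κ * t) - 1) := by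
            have : 1 ≤ Real.exp (κ * t) := Real.one_le_exp (by positivity)
            have := sub_nonneg.2 this
            positivity
          calc _ ≤ |K| * dist Y Y' * (κ⁻¹ * (Real.exp (κ * t) - 1)) := by
                gcongr; exact le_abs_self K
            _ ≤ _ := by gcongr; linarith
      _ = |K| * κ⁻¹ * dist Y Y' := by rw [Real.exp_neg]; field_simp
      _ ≤ _ := by
          have : |K| * κ⁻¹ ≤ 1 / 2 := by
            rw [← div_eq_mul_inv, div_le_iff₀ hκ0]; simp only [hκ]; linarith
          have := mul_le_mul_of_nonneg_right this hd
          simpa using this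
  have : Nonempty C(Icc (0 : ℝ) T, E) := ⟨0⟩
  set Y := hΦ.fixedPoint Φ with hY
  have hfix : Φ Y = Y := hΦ.fixedPoint_isFixedPt
  refine ⟨P Y, hPc Y, by simp [P], fun t ht => ?_⟩
  convert (hPd Y t).hasDerivWithinAt using 2
  have h1 : Y ⟨t, ht⟩ = Real.exp (-(κ * t)) • P Y t := by
    conv_lhs => rw [← hfix]
    rfl
  rw [projIcc_of_mem hT ht, h1, smul_smul, ← Real.exp_add]
  simp

/-! ### Operators and curves described by their coefficients in a Hilbert basis -/

section Basis

variable {ι H : Type*} [NormedAddCommGroup H] [InnerProductSpace ℂ H]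
  (b : HilbertBasis ι ℂ H)

theorem hasSum_norm_sq (x : H) : HasSum (fun i => ‖inner ℂ (b i) x‖ ^ 2) (‖x‖ ^ 2) := by
  have h := b.hasSum_inner_mul_inner x x
  have h2 := Complex.hasSum_re h
  convert h2 using 1
  · ext i
    rw [← inner_conj_symm x (b i), RCLike.conj_mul]
    norm_cast
  · rw [inner_self_eq_norm_sq_to_K]; norm_cast

theorem norm_le_mul_of_coeff_le {x y : H} {C : ℝ} (hC : 0 ≤ C)
    (h : ∀ i, ‖inner ℂ (b i) y‖ ≤ C * ‖inner ℂ (b i) x‖) : ‖y‖ ≤ C * ‖x‖ := by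
  refine le_of_sq_le_sq ?_ (by positivity)
  rw [mul_pow]
  refine hasSum_le (fun i => ?_) (hasSum_norm_sq b y) ((hasSum_norm_sq b x).mul_left _)
  rw [← mul_pow]
  gcongr
  exact h i

theorem ext_coeff {x y : H} (h : ∀ i, inner ℂ (b i) x = inner ℂ (b i) y) : x = y := by
  apply b.repr.injective
  ext i
  simpa [b.repr_apply_apply] using h i

theorem exists_of_coeff_le (x : H) {C : ℝ} {c : ι → ℂ}
    (h : ∀ i, ‖c i‖ ≤ C * ‖inner ℂ (b i) x‖) : ∃ y : H, ∀ i, inner ℂ (b i) y = c i := by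
  have hc : Memℓp c 2 := by
    refine memℓp_gen ?_
    refine Summable.of_nonneg_of_le (fun i => by positivity) (fun i => ?_)
      ((hasSum_norm_sq b x).summable.mul_left (C ^ 2))
    simp only [ENNReal.toReal_ofNat, Real.rpow_ofNat]
    rw [← mul_pow]
    gcongr
    exact h i
  refine ⟨b.repr.symm ⟨c, hc⟩, fun i => ?_⟩
  rw [← b.repr_apply_apply, LinearIsometryEquiv.apply_symm_apply]

theorem exists_diagonal (m : ι → ℂ) {C : ℝ} (hC : 0 ≤ C) (hm : ∀ i, ‖m i‖ ≤ C) :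
    ∃ A : H →L[ℂ] H, ‖A‖ ≤ C ∧ ∀ x i, inner ℂ (b i) (A x) = m i * inner ℂ (b i) x := by
  have hle : ∀ x i, ‖m i * inner ℂ (b i) x‖ ≤ C * ‖inner ℂ (b i) x‖ := fun x i => by
    rw [norm_mul]; gcongr; exact hm i
  choose A hA using fun x => exists_of_coeff_le b x (hle x)
  let A' : H →ₗ[ℂ] H :=
    { toFun := A
      map_add' := fun x y => ext_coeff b fun i => by simp [hA, mul_add]
      map_smul' := fun c x => ext_coeff b fun i => by
        simp [hA]; ring }
  have hn : ∀ x, ‖A' x‖ ≤ C * ‖x‖ := fun x =>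
    norm_le_mul_of_coeff_le b hC fun i => (congrArg norm (hA x i)).trans_le (hle x i)
  exact ⟨A'.mkContinuous C hn, A'.mkContinuous_norm_le hC hn, fun x i => hA x i⟩

theorem inner_diagonal_comm {m : ι → ℝ} {A : H →L[ℂ] H}
    (hA : ∀ x i, inner ℂ (b i) (A x) = (m i : ℂ) * inner ℂ (b i) x) (x y : H) :
    inner ℂ (A x) y = inner ℂ x (A y) := by
  refine (b.hasSum_inner_mul_inner (A x) y).unique ?_
  convert b.hasSum_inner_mul_inner x (A y) using 2 with i
  rw [← inner_conj_symm (A x), hA, hA, map_mul, inner_conj_symm, Complex.conj_ofReal]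
  ring

/-- The tails of the expansion of `y t` are dominated, coefficient by coefficient, by those of the
fixed vector `x`. Hence the partial sums converge uniformly in `t`. This gives strong continuity of
`cos(tΩ)` and `sin(tΩ)` although `Ω` is unbounded. -/
theorem continuous_of_coeff {x : H} {y : ℝ → H}
    (hle : ∀ t i, ‖inner ℂ (b i) (y t)‖ ≤ ‖inner ℂ (b i) x‖)
    (hc : ∀ i, Continuous fun t => inner ℂ (b i) (y t)) : Continuous y := by
  classical
  have hco : ∀ (z : H) (s : Finset ι) (i : ι),
      inner ℂ (b i) (z - ∑ j ∈ s, inner ℂ (b j) z • b j) = if i ∈ s then 0 else inner ℂ (b i) z := by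
    intro z s i
    rw [inner_sub_right, inner_sum]
    simp_rw [inner_smul_right, orthonormal_iff_ite.1 b.orthonormal]
    by_cases hi : i ∈ s <;> simp [hi]
  have hu : TendstoUniformly (fun (s : Finset ι) t => ∑ j ∈ s, inner ℂ (b j) (y t) • b j) y atTop := by
    rw [Metric.tendstoUniformly_iff]
    intro ε hε
    have hx : Tendsto (fun s : Finset ι => ∑ j ∈ s, inner ℂ (b j) x • b j) atTop (𝓝 x) := by
      simpa [HasSum, b.repr_apply_apply] using b.hasSum_repr x
    filter_upwards [hx.eventually (Metric.ball_mem_nhds x hε)] with s hs t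
    rw [dist_comm, dist_eq_norm] at hs
    rw [dist_eq_norm]
    refine lt_of_le_of_lt ?_ hs
    rw [← one_mul ‖x - _‖]
    refine norm_le_mul_of_coeff_le b zero_le_one fun i => ?_
    rw [hco, hco]
    split_ifs
    · simp
    · simpa using hle t i
  refine hu.continuous (Frequently.of_forall fun s => ?_)
  exact continuous_finsetSum _ fun i _ => (hc i).smul continuous_const

variable [NormedSpace ℝ H] [CompleteSpace H]

/-- Once the candidate derivative `y` is norm continuous, its primitive has the same coefficients as
`x`, so differentiability of each coefficient upgrades to differentiability in norm. -/
theorem hasDerivWithinAt_of_coeff {x y : ℝ → H} {T : ℝ} (hy : Continuous y)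
    (h : ∀ i, ∀ t ∈ Icc 0 T, HasDerivWithinAt (fun t => inner ℂ (b i) (x t))
      (inner ℂ (b i) (y t)) (Icc 0 T) t) (t : ℝ) (ht : t ∈ Icc 0 T) :
    HasDerivWithinAt x (y t) (Icc 0 T) t := by
  have hz : ∀ t, HasDerivAt (fun t => x 0 + ∫ τ in (0 : ℝ)..t, y τ) (y t) t := fun t =>
    (hy.integral_hasStrictDerivAt 0 t).hasDerivAt.const_add _
  have hzi : ∀ i t, HasDerivAt (fun t => inner ℂ (b i) (x 0 + ∫ τ in (0 : ℝ)..t, y τ))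
      (inner ℂ (b i) (y t)) t := fun i t => by
    have := (hasDerivAt_const t (b i)).inner ℂ (hz t)
    rwa [inner_zero_left, add_zero] at this
  have hT : 0 ≤ T := ht.1.trans ht.2
  have heq : ∀ t ∈ Icc 0 T, x t = x 0 + ∫ τ in (0 : ℝ)..t, y τ := fun t ht => by
    refine ext_coeff b fun i => ?_
    refine eq_of_derivWithin_eq (f := fun t => inner ℂ (b i) (x t))
      (g := fun t => inner ℂ (b i) (x 0 + ∫ τ in (0 : ℝ)..t, y τ)) (a := 0) (b := T)
      (fun t ht => (h i t ht).differentiableWithinAt)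
      (fun t ht => (hzi i t).differentiableAt.differentiableWithinAt) (fun t ht => ?_) (by simp) t ht
    have hu : UniqueDiffWithinAt ℝ (Icc 0 T) t :=
      uniqueDiffOn_Icc (ht.1.trans_lt ht.2) t (Ico_subset_Icc_self ht)
    rw [(h i t (Ico_subset_Icc_self ht)).derivWithin hu,
      (hzi i t).hasDerivWithinAt.derivWithin hu]
  exact (hz t).hasDerivWithinAt.congr (fun s hs => heq s hs) (heq t ht)

end Basis

/-! ### The abstract damped wave equation -/

/-- Existence and energy inequality for the damped wave equation `u'' + Ω² u + A u + B u' = 0`,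
where `Ω` is the diagonal operator with eigenvalues `ω i ≥ δ > 0`, `A` is bounded, symmetric and
non-negative, and `B` is bounded and accretive; `w = Ω u` and `v = u'`. -/
theorem exists_damped_wave {ι H : Type*} [NormedAddCommGroup H] [InnerProductSpace ℂ H]
    [NormedSpace ℝ H] [CompleteSpace H] (b : HilbertBasis ι ℂ H)
    {ω : ι → ℝ} {δ : ℝ} (hδ : 0 < δ) (hω : ∀ i, δ ≤ ω i) (A B : H →L[ℂ] H)
    (hA : ∀ x y, inner ℂ (A x) y = inner ℂ x (A y)) (hA0 : ∀ x, 0 ≤ (inner ℂ x (A x)).re)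
    (hB0 : ∀ x, 0 ≤ (inner ℂ x (B x)).re) {u₀ w₀ u₁ : H}
    (hw₀ : ∀ i, inner ℂ (b i) w₀ = (ω i : ℂ) * inner ℂ (b i) u₀) {T : ℝ} (hT : 0 ≤ T) :
    ∃ u v w : ℝ → H, u 0 = u₀ ∧ v 0 = u₁ ∧ Continuous v ∧ Continuous w ∧
      (∀ t i, inner ℂ (b i) (w t) = (ω i : ℂ) * inner ℂ (b i) (u t)) ∧
      (∀ t ∈ Icc 0 T, HasDerivWithinAt u (v t) (Icc 0 T) t) ∧
      (∀ f g : H, (∀ i, inner ℂ (b i) g = (ω i : ℂ) * inner ℂ (b i) f) → ∀ t ∈ Icc 0 T,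
        HasDerivWithinAt (fun τ => inner ℂ f (v τ))
          (-(inner ℂ g (w t) + inner ℂ f (A (u t)) + inner ℂ f (B (v t)))) (Icc 0 T) t) ∧
      ∀ t ∈ Icc 0 T, ‖w t‖ ^ 2 + ‖v t‖ ^ 2 ≤ ‖w₀‖ ^ 2 + ‖u₁‖ ^ 2 + ‖A‖ * ‖u₀‖ ^ 2 := by
  have hω0 : ∀ i, (ω i : ℂ) ≠ 0 := fun i => by
    exact_mod_cast (hδ.trans_le (hω i)).ne'
  choose C hC1 hC using fun t : ℝ => exists_diagonal b (fun i => ((Real.cos (t * ω i) : ℝ) : ℂ))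
    zero_le_one (fun i => by rw [Complex.norm_real]; exact Real.abs_cos_le_one _)
  choose S hS1 hS using fun t : ℝ => exists_diagonal b (fun i => ((Real.sin (t * ω i) : ℝ) : ℂ))
    zero_le_one (fun i => by rw [Complex.norm_real]; exact Real.abs_sin_le_one _)
  obtain ⟨O, hO1, hO⟩ := exists_diagonal b (fun i => ((ω i)⁻¹ : ℂ)) (inv_nonneg.2 hδ.le) fun i => by
    rw [norm_inv, Complex.norm_real, Real.norm_of_nonneg (hδ.le.trans (hω i))]
    exact inv_anti₀ hδ (hω i)
  have hCc : Continuous fun p : ℝ × H => C p.1 p.2 := by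
    refine continuous_prod_of_continuous_lipschitzWith' _ 1 (fun t => ?_) (fun x => ?_)
    · exact (C t).lipschitz.weaken (by exact_mod_cast hC1 t)
    · refine continuous_of_coeff b (x := x) (fun t i => ?_) fun i => ?_
      · rw [hC, norm_mul, Complex.norm_real]
        exact mul_le_of_le_one_left (norm_nonneg _) (Real.abs_cos_le_one _)
      · simp_rw [hC]; fun_prop
  have hSc : Continuous fun p : ℝ × H => S p.1 p.2 := by
    refine continuous_prod_of_continuous_lipschitzWith' _ 1 (fun t => ?_) (fun x => ?_)
    · exact (S t).lipschitz.weaken (by exact_mod_cast hS1 t)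
    · refine continuous_of_coeff b (x := x) (fun t i => ?_) fun i => ?_
      · rw [hS, norm_mul, Complex.norm_real]
        exact mul_le_of_le_one_left (norm_nonneg _) (Real.abs_sin_le_one _)
      · simp_rw [hS]; fun_prop
  have hCn : ∀ t x, ‖C t x‖ ≤ ‖x‖ := fun t x => by
    simpa using (C t).le_of_opNorm_le (hC1 t) x
  have hSn : ∀ t x, ‖S t x‖ ≤ ‖x‖ := fun t x => by
    simpa using (S t).le_of_opNorm_le (hS1 t) x
  -- Variation of constants: `z = (p, r)` is `(w, v)` in the frame rotating with the free evolution.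
  -- Here `C`, `S`, `O` are `cos(tΩ)`, `sin(tΩ)`, `Ω⁻¹`, so `u = O w`. From `w' = Ωv` and `v' = -Ωw
  -- - F` one gets `p' = S F`, `r' = -C F`.
  let W : ℝ → H × H → H := fun t z => C t z.1 + S t z.2
  let V : ℝ → H × H → H := fun t z => C t z.2 - S t z.1
  let F : ℝ → H × H → H := fun t z => A (O (W t z)) + B (V t z)
  let M : ℝ → H × H → H × H := fun t z => (S t (F t z), -C t (F t z))
  have hWn : ∀ t z, ‖W t z‖ ≤ 2 * ‖z‖ := fun t z => by
    refine (norm_add_le _ _).trans ?_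
    linarith [(hCn t z.1).trans (norm_fst_le z), (hSn t z.2).trans (norm_snd_le z)]
  have hVn : ∀ t z, ‖V t z‖ ≤ 2 * ‖z‖ := fun t z => by
    refine (norm_sub_le _ _).trans ?_
    linarith [(hCn t z.2).trans (norm_snd_le z), (hSn t z.1).trans (norm_fst_le z)]
  have hFn : ∀ t z, ‖F t z‖ ≤ (‖A‖ * ‖O‖ * 2 + ‖B‖ * 2) * ‖z‖ := fun t z => by
    refine (norm_add_le _ _).trans ?_
    have h1 : ‖A (O (W t z))‖ ≤ ‖A‖ * (‖O‖ * (2 * ‖z‖)) :=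
      A.le_opNorm_of_le (O.le_opNorm_of_le (hWn t z))
    have h2 : ‖B (V t z)‖ ≤ ‖B‖ * (2 * ‖z‖) := B.le_opNorm_of_le (hVn t z)
    linarith
  have hMsub : ∀ t z z', M t z - M t z' = M t (z - z') := fun t z z' => by
    have hF : F t (z - z') = F t z - F t z' := by
      simp only [F, W, V, Prod.fst_sub, Prod.snd_sub, map_sub, map_add]; abel
    ext
    · simp [M, hF]
    · simp [M, hF]; abel
  have hMn : ∀ t z, ‖M t z‖ ≤ ‖F t z‖ := fun t z => by
    rw [Prod.norm_def]
    exact max_le (hSn _ _) (by simpa [M] using hCn t (F t z))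
  have hWc : Continuous fun p : ℝ × (H × H) => W p.1 p.2 :=
    (hCc.comp (continuous_fst.prodMk continuous_snd.fst)).add
      (hSc.comp (continuous_fst.prodMk continuous_snd.snd))
  have hVc : Continuous fun p : ℝ × (H × H) => V p.1 p.2 :=
    (hCc.comp (continuous_fst.prodMk continuous_snd.snd)).sub
      (hSc.comp (continuous_fst.prodMk continuous_snd.fst))
  have hFc : Continuous fun p : ℝ × (H × H) => F p.1 p.2 :=
    (A.continuous.comp (O.continuous.comp hWc)).add (B.continuous.comp hVc)
  have hMc : Continuous fun p : ℝ × (H × H) => M p.1 p.2 :=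
    (hSc.comp (continuous_fst.prodMk hFc)).prodMk (hCc.comp (continuous_fst.prodMk hFc)).neg
  obtain ⟨z, hzc, hz0, hz⟩ := exists_forall_hasDerivWithinAt_of_lipschitz hMc
    (K := ‖A‖ * ‖O‖ * 2 + ‖B‖ * 2)
    (fun t x y => by rw [hMsub]; exact (hMn _ _).trans (hFn _ _)) hT (w₀, u₁)
  have hp : ∀ t ∈ Icc 0 T, HasDerivWithinAt (fun t => (z t).1) (S t (F t (z t))) (Icc 0 T) t :=
    fun t ht => (hz t ht).fst
  have hr : ∀ t ∈ Icc 0 T, HasDerivWithinAt (fun t => (z t).2) (-C t (F t (z t))) (Icc 0 T) t :=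
    fun t ht => (hz t ht).snd
  have hw0 : W 0 (z 0) = w₀ := ext_coeff b fun i => by simp [W, hz0, hC, hS]
  have hv0 : V 0 (z 0) = u₁ := ext_coeff b fun i => by simp [V, hz0, hC, hS]
  have hvc : Continuous fun t => V t (z t) := hVc.comp (continuous_id.prodMk hzc)
  have hwc : Continuous fun t => W t (z t) := hWc.comp (continuous_id.prodMk hzc)
  have hu : ∀ t ∈ Icc 0 T,
      HasDerivWithinAt (fun t => O (W t (z t))) (V t (z t)) (Icc 0 T) t := by
    refine hasDerivWithinAt_of_coeff b hvc fun i t ht => ?_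
    have hpi := (hasDerivWithinAt_const t (Icc 0 T) (b i)).inner ℂ (hp t ht)
    have hri := (hasDerivWithinAt_const t (Icc 0 T) (b i)).inner ℂ (hr t ht)
    have hcos : HasDerivAt (fun t : ℝ => ((Real.cos (t * ω i) : ℝ) : ℂ))
        ((-Real.sin (t * ω i) * ω i : ℝ) : ℂ) t :=
      ((Real.hasDerivAt_cos _).comp t (hasDerivAt_mul_const (ω i))).ofReal_comp
    have hsin : HasDerivAt (fun t : ℝ => ((Real.sin (t * ω i) : ℝ) : ℂ))
        ((Real.cos (t * ω i) * ω i : ℝ) : ℂ) t :=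
      ((Real.hasDerivAt_sin _).comp t (hasDerivAt_mul_const (ω i))).ofReal_comp
    have := ((hcos.hasDerivWithinAt.mul hpi).add (hsin.hasDerivWithinAt.mul hri)).const_mul
      ((ω i : ℂ)⁻¹)
    refine (this.congr_deriv ?_).congr (fun t _ => ?_) ?_
    rotate_left
    · simp only [W, hO, hC, hS, inner_add_right, Pi.add_apply, Pi.mul_apply]
    · simp only [W, hO, hC, hS, inner_add_right, Pi.add_apply, Pi.mul_apply]
    · simp only [V, inner_sub_right, inner_neg_right, hC, hS, inner_zero_left, add_zero]
      have := hω0 i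
      push_cast
      field_simp
      ring
  have hCS : ∀ x y t, inner ℂ (C t x) y = inner ℂ x (C t y) :=
    fun x y t => inner_diagonal_comm b (hC t) x y
  have hSS : ∀ x y t, inner ℂ (S t x) y = inner ℂ x (S t y) :=
    fun x y t => inner_diagonal_comm b (hS t) x y
  refine ⟨fun t => O (W t (z t)), fun t => V t (z t), fun t => W t (z t), ?_, hv0, hvc, hwc,
    fun t i => ?_, hu, fun f g hfg t ht => ?_, ?_⟩
  · refine ext_coeff b fun i => ?_
    change inner ℂ (b i) (O (W 0 (z 0))) = _
    rw [hw0, hO, hw₀, inv_mul_cancel_left₀ (hω0 i)]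
  · rw [hO, mul_inv_cancel_left₀ (hω0 i)]
  -- `v` itself need not be differentiable in `H`. Moving the rotation onto `f` gives `⟨f, v⟩ = ⟨C
  -- f, r⟩ - ⟨S f, p⟩`, and `C f`, `S f` are differentiable because `f` lies in the domain of `Ω`.
  · have hCf : HasDerivWithinAt (fun t => C t f) (-S t g) (Icc 0 T) t := by
      refine hasDerivWithinAt_of_coeff b (y := fun t => -S t g)
        (hSc.comp (continuous_id.prodMk continuous_const)).neg (fun i t _ => ?_) t ht
      have hcos : HasDerivAt (fun t : ℝ => ((Real.cos (t * ω i) : ℝ) : ℂ))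
          ((-Real.sin (t * ω i) * ω i : ℝ) : ℂ) t :=
        ((Real.hasDerivAt_cos _).comp t (hasDerivAt_mul_const (ω i))).ofReal_comp
      simp_rw [hC]
      refine (hcos.mul_const (inner ℂ (b i) f)).hasDerivWithinAt.congr_deriv ?_
      rw [inner_neg_right, hS, hfg]; push_cast; ring
    have hSf : HasDerivWithinAt (fun t => S t f) (C t g) (Icc 0 T) t := by
      refine hasDerivWithinAt_of_coeff b (y := fun t => C t g)
        (hCc.comp (continuous_id.prodMk continuous_const)) (fun i t _ => ?_) t ht
      have hsin : HasDerivAt (fun t : ℝ => ((Real.sin (t * ω i) : ℝ) : ℂ))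
          ((Real.cos (t * ω i) * ω i : ℝ) : ℂ) t :=
        ((Real.hasDerivAt_sin _).comp t (hasDerivAt_mul_const (ω i))).ofReal_comp
      simp_rw [hS]
      refine (hsin.mul_const (inner ℂ (b i) f)).hasDerivWithinAt.congr_deriv ?_
      rw [hC, hfg]; push_cast; ring
    have h := (hCf.inner ℂ (hr t ht)).sub (hSf.inner ℂ (hp t ht))
    have hCC : C t (C t (F t (z t))) + S t (S t (F t (z t))) = F t (z t) :=
      ext_coeff b fun i => by
        rw [inner_add_right, hC, hC, hS, hS, ← mul_assoc, ← mul_assoc, ← add_mul]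
        norm_cast
        rw [← sq, ← sq, Real.cos_sq_add_sin_sq]; simp
    refine (h.congr_deriv ?_).congr (fun τ _ => ?_) ?_
    rotate_left
    · simp only [V, inner_sub_right, hCS, hSS, Pi.sub_apply]
    · simp only [V, inner_sub_right, hCS, hSS, Pi.sub_apply]
    · have h2 : inner ℂ f (A (O (W t (z t)))) + inner ℂ f (B (V t (z t)))
          = inner ℂ f (C t (C t (F t (z t)))) + inner ℂ f (S t (S t (F t (z t)))) := by
        rw [← inner_add_right, ← inner_add_right, hCC]
      rw [add_assoc, h2]
      simp only [W, inner_add_right, inner_neg_left, hCS, hSS, map_neg, inner_neg_right]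
      ring
  · have hWV : ∀ t, ‖W t (z t)‖ ^ 2 + ‖V t (z t)‖ ^ 2 = ‖(z t).1‖ ^ 2 + ‖(z t).2‖ ^ 2 := fun t => by
      refine ((hasSum_norm_sq b _).add (hasSum_norm_sq b _)).unique ?_
      convert (hasSum_norm_sq b (z t).1).add (hasSum_norm_sq b (z t).2) using 2 with i
      simp only [W, V, inner_add_right, inner_sub_right, hC, hS]
      generalize inner ℂ (b i) (z t).1 = p
      generalize inner ℂ (b i) (z t).2 = r
      have := Real.cos_sq_add_sin_sq (t * ω i)
      rw [← Complex.normSq_eq_norm_sq, ← Complex.normSq_eq_norm_sq, ← Complex.normSq_eq_norm_sq,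
        ← Complex.normSq_eq_norm_sq]
      simp only [Complex.normSq_apply, Complex.add_re, Complex.add_im, Complex.sub_re,
        Complex.sub_im, Complex.re_ofReal_mul, Complex.im_ofReal_mul]
      linear_combination (p.re * p.re + p.im * p.im + r.re * r.re + r.im * r.im) * this
    -- The energy is written with `p`, `r` in place of `w`, `v`: the rotation preserves the sum of
    -- squares, and only `p`, `r` are known to be differentiable. In its derivative the `A` terms
    -- cancel and `-2 Re⟨v, Bv⟩` remains.
    let En : ℝ → ℝ := fun t => (inner ℂ (z t).1 (z t).1).re + (inner ℂ (z t).2 (z t).2).re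
      + (inner ℂ (O (W t (z t))) (A (O (W t (z t))))).re
    have hsq : ∀ x : H, (inner ℂ x x).re = ‖x‖ ^ 2 := fun x => by
      rw [inner_self_eq_norm_sq_to_K]; norm_cast
    have hEd : ∀ t ∈ Icc 0 T, HasDerivWithinAt En
        (-2 * (inner ℂ (V t (z t)) (B (V t (z t)))).re) (Icc 0 T) t := fun t ht => by
      have hre : ∀ {f : ℝ → ℂ} {f' : ℂ}, HasDerivWithinAt f f' (Icc 0 T) t →
          HasDerivWithinAt (fun t => (f t).re) f'.re (Icc 0 T) t := fun h =>
        (Complex.reCLM.hasFDerivAt.comp_hasDerivWithinAt t h)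
      have hAu : HasDerivWithinAt (fun t => A (O (W t (z t)))) (A (V t (z t))) (Icc 0 T) t := by
        refine hasDerivWithinAt_of_coeff b (y := fun t => A (V t (z t)))
          (A.continuous.comp hvc) (fun i t ht => ?_) t ht
        -- Symmetry moves `A` to the fixed vector `b i`, so only the derivative of `u` is needed.
        simp_rw [← hA]
        simpa using (hasDerivWithinAt_const t (Icc 0 T) (A (b i))).inner ℂ (hu t ht)
      have h := ((hre ((hp t ht).inner ℂ (hp t ht))).add (hre ((hr t ht).inner ℂ (hr t ht)))).add
        (hre ((hu t ht).inner ℂ hAu))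
      refine h.congr_deriv ?_
      have hsymm : ∀ x y : H, (inner ℂ x y).re = (inner ℂ y x).re := fun x y => by
        rw [← inner_conj_symm, Complex.conj_re]
      have hF : inner ℂ (V t (z t)) (F t (z t)) = inner ℂ (V t (z t)) (A (O (W t (z t)))) +
          inner ℂ (V t (z t)) (B (V t (z t))) := inner_add_right _ _ _
      have hF' : inner ℂ (V t (z t)) (F t (z t)) = inner ℂ (z t).2 (C t (F t (z t))) -
          inner ℂ (z t).1 (S t (F t (z t))) := by
        simp only [V, inner_sub_left, hCS, hSS]
      have h1 := congrArg Complex.re (hF.symm.trans hF')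
      simp only [Complex.add_re, Complex.sub_re] at h1
      rw [← hA]
      simp only [Complex.add_re, inner_neg_left, inner_neg_right, Complex.neg_re]
      rw [hsymm (S t (F t (z t))), hsymm (C t (F t (z t))), hsymm (A (O (W t (z t))))]
      linarith
    have hanti : AntitoneOn En (Icc 0 T) := by
      refine antitoneOn_of_hasDerivWithinAt_nonpos (convex_Icc 0 T)
        (fun t ht => (hEd t ht).continuousWithinAt)
        (fun t ht => (hEd t (interior_subset ht)).mono interior_subset) fun t _ => ?_
      linarith [hB0 (V t (z t))]
    intro t ht
    have h0 := hanti (left_mem_Icc.2 hT) ht ht.1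
    have hu0 : O (W 0 (z 0)) = u₀ := by
      refine ext_coeff b fun i => ?_
      rw [hw0, hO, hw₀, inv_mul_cancel_left₀ (hω0 i)]
    have h3 : (inner ℂ u₀ (A u₀)).re ≤ ‖A‖ * ‖u₀‖ ^ 2 := by
      refine (Complex.re_le_norm _).trans ((norm_inner_le_norm _ _).trans ?_)
      have := A.le_opNorm u₀
      nlinarith [norm_nonneg u₀]
    simp only [En, hsq, hu0] at h0
    rw [hWV]
    simp only [hz0] at h0
    linarith [hA0 (O (W t (z t)))]

/-! ### Multiplication operators -/

/-- Multiplication by an essentially bounded real function on `L²(0,1)`. -/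
def mulOp (a : LInf) : L2 →L[ℂ] L2 :=
  LinearMap.mkContinuous
    { toFun := fun f => (a • f : L2)
      map_add' := fun f g => Lp.add_smul a f g
      map_smul' := fun c f => by
        refine Lp.ext ?_
        filter_upwards [Lp.coeFn_lpSMul (r := 2) a (c • f), Lp.coeFn_lpSMul (r := 2) a f,
          Lp.coeFn_smul c f, Lp.coeFn_smul c (a • f : L2)] with x h1 h2 h3 h4
        rw [RingHom.id_apply, h1, h4, Pi.smul_apply', Pi.smul_apply, h3, h2, Pi.smul_apply',
          Pi.smul_apply, smul_comm] }
    ‖a‖ fun f => Lp.norm_smul_le a f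

theorem mulOp_apply (a : LInf) (f : L2) : mulOp a f = (a • f : L2) := rfl

theorem norm_mulOp_le (a : LInf) : ‖mulOp a‖ ≤ ‖a‖ :=
  LinearMap.mkContinuous_norm_le _ (norm_nonneg _) _

theorem coeFn_mulOp (a : LInf) (f : L2) : mulOp a f =ᵐ[mu] fun x => (a x : ℂ) * f x := by
  filter_upwards [Lp.coeFn_lpSMul (r := 2) a f] with x hx
  rw [mulOp_apply, hx]
  simp

theorem inner_mulOp_comm (a : LInf) (f g : L2) :
    inner ℂ (mulOp a f) g = inner ℂ f (mulOp a g) := by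
  rw [L2.inner_def, L2.inner_def]
  refine integral_congr_ae ?_
  filter_upwards [coeFn_mulOp a f, coeFn_mulOp a g] with x hf hg
  rw [hf, hg, RCLike.inner_apply, RCLike.inner_apply]
  simp
  ring

theorem re_inner_mulOp_nonneg {a : LInf} (ha : ∀ᵐ x ∂mu, 0 ≤ a x) (f : L2) :
    0 ≤ (inner ℂ f (mulOp a f)).re := by
  rw [L2.inner_def, ← RCLike.re_to_complex, ← integral_re (L2.integrable_inner f (mulOp a f))]
  refine integral_nonneg_of_ae ?_
  filter_upwards [coeFn_mulOp a f, ha] with x hf hx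
  rw [hf, RCLike.inner_apply, mul_assoc, RCLike.mul_conj]
  simp only [RCLike.re_to_complex, Pi.zero_apply]
  change 0 ≤ ((a x : ℂ) * ((‖f x‖ : ℝ) : ℂ) ^ 2).re
  rw [← Complex.ofReal_pow, ← Complex.ofReal_mul, Complex.ofReal_re]
  positivity

/-! ### Primitives -/

theorem mu_restrict_Ioc {x y : ℝ} (hx : 0 ≤ x) (hy : y ≤ 1) :
    mu.restrict (Ioc x y) = volume.restrict (Ioc x y) := by
  rw [mu, Measure.restrict_congr_set Ioo_ae_eq_Ioc, Measure.restrict_restrict measurableSet_Ioc,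
    inter_eq_left.2 (Ioc_subset_Ioc hx hy)]

theorem intervalIntegral_eq_setIntegral_mu {h : ℝ → ℂ} {x y : ℝ} (hx : 0 ≤ x) (hxy : x ≤ y)
    (hy : y ≤ 1) : ∫ t in x..y, h t = ∫ t in Ioc x y, h t ∂mu := by
  rw [intervalIntegral.integral_of_le hxy, mu_restrict_Ioc hx hy]

theorem integral_congr_ae_mu {h k : ℝ → ℂ} (hk : h =ᵐ[mu] k) {x y : ℝ} (hx : 0 ≤ x) (hxy : x ≤ y)
    (hy : y ≤ 1) : ∫ t in x..y, h t = ∫ t in x..y, k t := by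
  rw [intervalIntegral_eq_setIntegral_mu hx hxy hy, intervalIntegral_eq_setIntegral_mu hx hxy hy]
  exact integral_congr_ae (ae_restrict_of_ae hk)

theorem integrable_coeFn (h : L2) : Integrable h mu := (Lp.memLp h).integrable one_le_two

theorem intervalIntegrable_of_integrable_mu {h : ℝ → ℂ} (hh : Integrable h mu) :
    IntervalIntegrable h volume 0 1 :=
  (intervalIntegrable_iff_integrableOn_Ioo_of_le zero_le_one).2 hh

theorem intervalIntegrable_coeFn (h : L2) {x y : ℝ} (hx : x ∈ Icc (0 : ℝ) 1)
    (hy : y ∈ Icc (0 : ℝ) 1) : IntervalIntegrable h volume x y := by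
  refine (intervalIntegrable_of_integrable_mu (integrable_coeFn h)).mono_set ?_
  rw [uIcc_of_le (zero_le_one' ℝ)]
  exact uIcc_subset_Icc hx hy

/-- Cauchy–Schwarz against the indicator of `(x, y]`. The resulting modulus of continuity makes
primitives of the unit ball equicontinuous, hence the primitive map compact. -/
theorem norm_integral_le_sqrt (h : L2) {x y : ℝ} (hx : 0 ≤ x) (hxy : x ≤ y) (hy : y ≤ 1) :
    ‖∫ t in x..y, h t‖ ≤ √(y - x) * ‖h‖ := by
  have hfin : mu (Ioc x y) ≠ ∞ := measure_ne_top _ _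
  rw [intervalIntegral_eq_setIntegral_mu hx hxy hy,
    ← L2.inner_indicatorConstLp_one measurableSet_Ioc hfin]
  refine (norm_inner_le_norm _ _).trans ?_
  gcongr
  rw [norm_indicatorConstLp (by norm_num) (by norm_num)]
  have : mu.real (Ioc x y) ≤ y - x := by
    rw [Measure.real, ← Measure.restrict_apply_univ, mu_restrict_Ioc hx hy]
    simp [hxy]
  rw [Real.sqrt_eq_rpow]
  simp only [norm_one, ENNReal.toReal_ofNat, one_mul]
  gcongr

theorem norm_integral_sub_le_sqrt (h : L2) (x y : Icc (0 : ℝ) 1) :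
    ‖(∫ t in (0 : ℝ)..x, h t) - ∫ t in (0 : ℝ)..y, h t‖ ≤ √(dist x y) * ‖h‖ := by
  have h0 : (0 : ℝ) ∈ Icc (0 : ℝ) 1 := ⟨le_rfl, zero_le_one⟩
  rw [intervalIntegral.integral_interval_sub_left (intervalIntegrable_coeFn h h0 x.2)
    (intervalIntegrable_coeFn h h0 y.2)]
  rcases le_total (x : ℝ) y with hxy | hxy
  · rw [intervalIntegral.integral_symm, norm_neg, dist_comm, Subtype.dist_eq, Real.dist_eq,
      abs_of_nonneg (sub_nonneg.2 hxy)]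
    exact norm_integral_le_sqrt h x.2.1 hxy y.2.2
  · rw [Subtype.dist_eq, Real.dist_eq, abs_of_nonneg (sub_nonneg.2 hxy)]
    exact norm_integral_le_sqrt h y.2.1 hxy x.2.2

/-- The primitive `x ↦ ∫₀ˣ h` of `h ∈ L²(0,1)`, as a continuous function on `[0,1]`. -/
def primitive : L2 →L[ℂ] BoundedContinuousFunction (Icc (0 : ℝ) 1) ℂ :=
  LinearMap.mkContinuous
    { toFun := fun h => BoundedContinuousFunction.mkOfCompact
        ⟨fun x => ∫ t in (0 : ℝ)..x, h t, by
          refine Metric.continuous_iff'.2 fun x ε hε => ?_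
          have hc : Continuous fun y : Icc (0 : ℝ) 1 => √(dist y x) * ‖h‖ := by fun_prop
          have := hc.tendsto x
          simp only [dist_self, Real.sqrt_zero, zero_mul] at this
          filter_upwards [this.eventually (gt_mem_nhds hε)] with y hy
          rw [dist_eq_norm]
          exact (norm_integral_sub_le_sqrt h y x).trans_lt hy⟩
      map_add' := fun f g => by
        ext x
        have h0 : (0 : ℝ) ∈ Icc (0 : ℝ) 1 := ⟨le_rfl, zero_le_one⟩
        simp only [BoundedContinuousFunction.mkOfCompact_apply, ContinuousMap.coe_mk,
          BoundedContinuousFunction.add_apply]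
        rw [← intervalIntegral.integral_add (intervalIntegrable_coeFn f h0 x.2)
          (intervalIntegrable_coeFn g h0 x.2)]
        exact integral_congr_ae_mu (Lp.coeFn_add f g) le_rfl x.2.1 x.2.2
      map_smul' := fun c f => by
        ext x
        simp only [BoundedContinuousFunction.mkOfCompact_apply, ContinuousMap.coe_mk,
          BoundedContinuousFunction.coe_smul, RingHom.id_apply]
        rw [← intervalIntegral.integral_smul]
        exact integral_congr_ae_mu (Lp.coeFn_smul c f) le_rfl x.2.1 x.2.2 }
    1 fun h => by
      rw [one_mul]
      refine (BoundedContinuousFunction.norm_le (norm_nonneg _)).2 fun x => ?_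
      refine (norm_integral_le_sqrt h le_rfl x.2.1 x.2.2).trans ?_
      refine mul_le_of_le_one_left (norm_nonneg _) (Real.sqrt_le_one.2 ?_)
      simpa using x.2.2

theorem primitive_apply (h : L2) (x : Icc (0 : ℝ) 1) : primitive h x = ∫ t in (0 : ℝ)..x, h t := rfl

/-- The inclusion of `C([0,1])` in `L²(0,1)`. -/
def toL2 : BoundedContinuousFunction (Icc (0 : ℝ) 1) ℂ →L[ℂ] L2 :=
  (BoundedContinuousFunction.toLp 2 mu ℂ).comp
    (BoundedContinuousFunction.compContinuousCLM ℂ ℂ ⟨projIcc 0 1 zero_le_one, continuous_projIcc⟩)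

theorem coeFn_toL2 (f : BoundedContinuousFunction (Icc (0 : ℝ) 1) ℂ) :
    toL2 f =ᵐ[mu] fun x => f (projIcc 0 1 zero_le_one x) :=
  BoundedContinuousFunction.coeFn_toLp 2 mu ℂ _

theorem toL2_eq_of_ae {f : BoundedContinuousFunction (Icc (0 : ℝ) 1) ℂ} {g : L2} {F : ℝ → ℂ}
    (hg : g =ᵐ[mu] F) (hF : ∀ x : Icc (0 : ℝ) 1, f x = F x) : g = toL2 f := by
  refine Lp.ext (hg.trans ((coeFn_toL2 f).trans ?_).symm)
  filter_upwards [ae_restrict_mem measurableSet_Ioo] with x hx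
  rw [hF, projIcc_of_mem zero_le_one (Ioo_subset_Icc_self hx)]

theorem toL2_injective : Function.Injective toL2 := by
  intro f g hfg
  have h : (fun x => f (projIcc 0 1 zero_le_one x)) =ᵐ[volume.restrict (Icc (0 : ℝ) 1)]
      fun x => g (projIcc 0 1 zero_le_one x) := by
    rw [← Measure.restrict_congr_set Ioo_ae_eq_Icc]
    refine (coeFn_toL2 f).symm.trans (EventuallyEq.trans ?_ (coeFn_toL2 g))
    rw [hfg]
  have := Measure.eqOn_Icc_of_ae_eq volume zero_ne_one h
    (f.continuous.comp continuous_projIcc).continuousOn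
    (g.continuous.comp continuous_projIcc).continuousOn
  ext x
  simpa using this x.2

/-- The Volterra operator on `L²(0,1)`. -/
def volterra : L2 →L[ℂ] L2 := toL2.comp primitive

theorem volterra_apply (h : L2) : volterra h = toL2 (primitive h) := rfl

theorem coeFn_volterra (h : L2) : volterra h =ᵐ[mu] fun x => ∫ t in (0 : ℝ)..x, h t := by
  refine (coeFn_toL2 _).trans ?_
  filter_upwards [ae_restrict_mem measurableSet_Ioo] with x hx
  rw [projIcc_of_mem zero_le_one (Ioo_subset_Icc_self hx)]
  exact primitive_apply h _

/-- Lebesgue differentiation recovers `h` almost everywhere from its primitive. -/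
theorem volterra_injective : Function.Injective volterra := by
  rw [injective_iff_map_eq_zero]
  intro h hh
  have hp : primitive h = 0 := toL2_injective (by rw [← volterra_apply, hh, map_zero])
  refine Lp.ext ?_
  have h1 := (intervalIntegrable_of_integrable_mu (integrable_coeFn h)).ae_hasDerivAt_integral
  filter_upwards [ae_restrict_of_ae h1, ae_restrict_mem measurableSet_Ioo, Lp.coeFn_zero ℂ 2 mu]
    with x hx hx01 h0
  rw [h0, Pi.zero_apply]
  rw [uIcc_of_le (zero_le_one' ℝ)] at hx
  refine (hx (Ioo_subset_Icc_self hx01) 0 ⟨le_rfl, zero_le_one⟩).unique ?_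
  refine (hasDerivAt_const x (0 : ℂ)).congr_of_eventuallyEq ?_
  filter_upwards [isOpen_Ioo.mem_nhds hx01] with y hy
  rw [← primitive_apply h ⟨y, Ioo_subset_Icc_self hy⟩, hp]
  rfl

theorem isCompactOperator_primitive : IsCompactOperator primitive := by
  refine (isCompactOperator_iff_isCompact_closure_image_closedBall
    (primitive : L2 →ₗ[ℂ] BoundedContinuousFunction (Icc (0 : ℝ) 1) ℂ) one_pos).2 ?_
  refine BoundedContinuousFunction.arzela_ascoli (Metric.closedBall (0 : ℂ) 1)
    (isCompact_closedBall _ _) _ ?_ ?_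
  · rintro _ x ⟨h, hh, rfl⟩
    rw [mem_closedBall_zero_iff] at hh ⊢
    have := (norm_integral_le_sqrt h le_rfl x.2.1 x.2.2)
    refine this.trans ?_
    have h1 : √((x : ℝ) - 0) ≤ 1 := Real.sqrt_le_one.2 (by simpa using x.2.2)
    exact mul_le_one₀ h1 (norm_nonneg _) hh
  · refine Metric.equicontinuous_of_continuity_modulus (fun r => √r) ?_ _ ?_
    · simpa using (Real.continuous_sqrt.tendsto 0)
    · rintro x y ⟨_, h, hh, rfl⟩
      rw [mem_closedBall_zero_iff] at hh
      rw [dist_eq_norm]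
      refine (norm_integral_sub_le_sqrt h x y).trans ?_
      exact mul_le_of_le_one_right (Real.sqrt_nonneg _) hh

theorem isCompactOperator_volterra : IsCompactOperator volterra :=
  isCompactOperator_primitive.clm_comp toL2

/-- The constant function `1` in `L²(0,1)`. -/
def one : L2 := toL2 1

theorem coeFn_one : one =ᵐ[mu] fun _ => 1 := coeFn_toL2 1

theorem inner_one (h : L2) : inner ℂ one h = ∫ x, h x ∂mu := by
  rw [L2.inner_def]
  refine integral_congr_ae ?_
  filter_upwards [coeFn_one] with x hx
  rw [hx, RCLike.inner_apply]; simp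

theorem primitive_one_eq_inner (h : L2) : primitive h ⟨1, zero_le_one, le_rfl⟩ = inner ℂ one h := by
  rw [inner_one, primitive_apply, intervalIntegral_eq_setIntegral_mu le_rfl zero_le_one le_rfl,
    mu_restrict_Ioc le_rfl le_rfl, Measure.restrict_congr_set Ioo_ae_eq_Ioc.symm]

theorem primitive_zero (h : L2) : primitive h ⟨0, le_rfl, zero_le_one⟩ = 0 := by
  rw [primitive_apply]; simp

theorem inner_one_one : inner ℂ one one = 1 := by
  rw [inner_one, integral_congr_ae coeFn_one]
  simp

/-- Integration by parts. -/
theorem inner_volterra_add (k h : L2) :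
    inner ℂ k (volterra h) + inner ℂ (volterra k) h = inner ℂ k one * inner ℂ one h := by
  have hkc : Integrable (fun x => (starRingEnd ℂ) (k x)) mu :=
    (integrable_coeFn k).congr (Eventually.of_forall fun _ => rfl) |> fun h => by
      simpa using (Complex.conjCLE : ℂ →L[ℝ] ℂ).integrable_comp h
  have hh := integrable_coeFn h
  have hprod : Integrable (fun p : ℝ × ℝ => (starRingEnd ℂ) (k p.1) * h p.2) (mu.prod mu) :=
    hkc.mul_prod hh
  have hS : MeasurableSet {p : ℝ × ℝ | p.2 ≤ p.1} := measurableSet_le measurable_snd measurable_fst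
  have hV : ∀ (h : L2), ∀ᵐ x ∂mu, volterra h x = ∫ t, (if t ≤ x then h t else 0) ∂mu := fun h => by
    filter_upwards [coeFn_volterra h, ae_restrict_mem measurableSet_Ioo] with x hx hx01
    rw [hx, intervalIntegral_eq_setIntegral_mu le_rfl hx01.1.le hx01.2.le,
      ← integral_indicator measurableSet_Ioc]
    refine integral_congr_ae ?_
    filter_upwards [ae_restrict_mem measurableSet_Ioo] with t ht
    by_cases htx : t ≤ x
    · simp [indicator, ht.1, htx]
    · simp [indicator, htx]
  have h1 : inner ℂ k (volterra h) =
      ∫ x, ∫ t, (if t ≤ x then (starRingEnd ℂ) (k x) * h t else 0) ∂mu ∂mu := by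
    rw [L2.inner_def]
    refine integral_congr_ae ?_
    filter_upwards [hV h] with x hx
    rw [RCLike.inner_apply, hx, mul_comm, ← integral_const_mul]
    congr 1; ext t; split_ifs <;> simp
  have h2 : inner ℂ (volterra k) h =
      ∫ t, ∫ x, (if x ≤ t then (starRingEnd ℂ) (k x) * h t else 0) ∂mu ∂mu := by
    rw [L2.inner_def]
    refine integral_congr_ae ?_
    filter_upwards [hV k] with t ht
    rw [RCLike.inner_apply, ht, ← integral_conj, ← integral_const_mul]
    congr 1; ext x; split_ifs <;> simp [mul_comm]
  have h3 : inner ℂ k one * inner ℂ one h = ∫ x, ∫ t, (starRingEnd ℂ) (k x) * h t ∂mu ∂mu := by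
    rw [← inner_conj_symm, inner_one, inner_one, ← integral_conj]
    simp_rw [integral_const_mul, integral_mul_const]
  have hI1 : Integrable (fun p : ℝ × ℝ =>
      if p.2 ≤ p.1 then (starRingEnd ℂ) (k p.1) * h p.2 else 0) (mu.prod mu) :=
    hprod.indicator hS
  have hI2 : Integrable (fun p : ℝ × ℝ =>
      if p.1 ≤ p.2 then (starRingEnd ℂ) (k p.1) * h p.2 else 0) (mu.prod mu) :=
    hprod.indicator (measurableSet_le measurable_fst measurable_snd)
  -- By Fubini the two terms are integrals of `conj k(x) h(t)` over the triangles `t ≤ x` and `x ≤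
  -- t`. They fill the square and overlap only on the null diagonal.
  rw [h1, h2, h3, integral_integral_swap (f := fun t x =>
    if x ≤ t then (starRingEnd ℂ) (k x) * h t else 0) hI2.swap,
    ← integral_add hI1.integral_prod_left hI2.integral_prod_left]
  refine integral_congr_ae ?_
  filter_upwards [hI1.prod_right_ae, hI2.prod_right_ae] with x hx1 hx2
  rw [← integral_add hx1 hx2]
  refine integral_congr_ae ?_
  have hne : ∀ᵐ t ∂mu, t ≠ x := ae_restrict_of_ae (by
    simp [ae_iff, measure_singleton])
  filter_upwards [hne] with t ht
  rcases lt_or_gt_of_ne ht with h | h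
  · simp [h.le, h.not_ge]
  · simp [h.le, h.not_ge]

/-! ### The Dirichlet problem in terms of the Volterra operator -/

/-- Here `d = f'` and `κ = f'(0)`. The condition at `0` is built into `volterra`, while the one at
`1` becomes orthogonality of `d` to the constants. All later arguments use only these relations
between bounded operators. -/
theorem isDirichletSL_iff {q : ℝ → ℝ} {Q : LInf} (hQ : Q =ᵐ[mu] q) (f g : L2) :
    IsDirichletSL q f g ↔ ∃ (d : L2) (κ : ℂ), f = volterra d ∧ inner ℂ one d = 0 ∧
      d = κ • one + volterra (mulOp Q f - g) := by
  set p : L2 := mulOp Q f - g with hp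
  have hpae : ∀ F : ℝ → ℂ, f =ᵐ[mu] F → p =ᵐ[mu] fun t => (q t : ℂ) * F t - g t := fun F hF => by
    filter_upwards [hF, Lp.coeFn_sub (mulOp Q f) g, coeFn_mulOp Q f, hQ] with t h1 h2 h3 h4
    rw [hp, h2, Pi.sub_apply, h3, h1, h4]
  have hDc : ∀ κ : ℂ, κ • one + volterra p = toL2 (κ • 1 + primitive p) := fun κ => by
    rw [map_add, map_smul]; rfl
  constructor
  · rintro ⟨F, D, hfF, hFD, hD, hF0, hF1⟩
    have hDe : ∀ x : Icc (0 : ℝ) 1, (D 0 • 1 + primitive p : BoundedContinuousFunction _ ℂ) x = D x :=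
      fun x => by
        rw [hD x x.2, ← integral_congr_ae_mu (hpae F hfF) le_rfl x.2.1 x.2.2, ← primitive_apply]
        simp
    set d : L2 := D 0 • one + volterra p with hd
    have hdD : d =ᵐ[mu] D := by
      rw [hd, hDc]
      refine (coeFn_toL2 _).trans ?_
      filter_upwards [ae_restrict_mem measurableSet_Ioo] with x hx
      rw [hDe, projIcc_of_mem zero_le_one (Ioo_subset_Icc_self hx)]
    have hDcont : ContinuousOn D (Icc 0 1) := by
      refine ((D 0 • 1 + primitive p : BoundedContinuousFunction _ ℂ).continuous.comp
        (continuous_projIcc (h := zero_le_one' ℝ))).continuousOn.congr fun x hx => ?_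
      rw [Function.comp_apply, hDe, projIcc_of_mem zero_le_one hx]
    have hFx : ∀ x : Icc (0 : ℝ) 1, primitive d x = F x := fun x => by
      have hsub : Icc (0 : ℝ) x ⊆ Icc 0 1 := Icc_subset_Icc_right x.2.2
      rw [primitive_apply, integral_congr_ae_mu hdD le_rfl x.2.1 x.2.2,
        intervalIntegral.integral_eq_sub_of_hasDerivAt_of_le x.2.1
          (fun y hy => ((hFD y (hsub hy)).continuousWithinAt).mono hsub)
          (fun y hy => (hFD y (hsub (Ioo_subset_Icc_self hy))).hasDerivAt
            (Icc_mem_nhds hy.1 (hy.2.trans_le x.2.2)))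
          ((hDcont.mono hsub).intervalIntegrable_of_Icc x.2.1), hF0, sub_zero]
    refine ⟨d, D 0, toL2_eq_of_ae hfF hFx, ?_, rfl⟩
    rw [← primitive_one_eq_inner, hFx, hF1]
  · rintro ⟨d, κ, hf, hd1, hd⟩
    let Dc : BoundedContinuousFunction (Icc (0 : ℝ) 1) ℂ := κ • 1 + primitive p
    let D : ℝ → ℂ := fun x => Dc (projIcc 0 1 zero_le_one x)
    have hDcont : Continuous D := Dc.continuous.comp continuous_projIcc
    have hdD : d =ᵐ[mu] D := by
      rw [hd, hDc]
      exact coeFn_toL2 _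
    have hFx : ∀ x : Icc (0 : ℝ) 1, primitive d x = ∫ t in (0 : ℝ)..x, D t := fun x =>
      integral_congr_ae_mu hdD le_rfl x.2.1 x.2.2
    have hfF : f =ᵐ[mu] fun x => ∫ t in (0 : ℝ)..x, D t := by
      rw [hf]
      refine (coeFn_volterra d).trans ?_
      filter_upwards [ae_restrict_mem measurableSet_Ioo] with x hx
      exact hFx ⟨x, Ioo_subset_Icc_self hx⟩
    refine ⟨fun x => ∫ t in (0 : ℝ)..x, D t, D, hfF, fun x _ =>
      (hDcont.integral_hasStrictDerivAt 0 x).hasDerivAt.hasDerivWithinAt, fun x hx => ?_, by simp, ?_⟩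
    · have h0 : D 0 = κ := by
        simp only [D, Dc, projIcc_left, BoundedContinuousFunction.add_apply, primitive_zero]
        simp
      rw [← integral_congr_ae_mu (hpae _ hfF) le_rfl hx.1 hx.2, h0,
        ← primitive_apply p ⟨x, hx⟩]
      simp only [D, Dc, projIcc_of_mem zero_le_one hx, BoundedContinuousFunction.add_apply]
      simp
    · rw [← hd1, ← primitive_one_eq_inner]
      exact (hFx ⟨1, zero_le_one, le_rfl⟩).symm

/-- Integration by parts for `p = d'` as a derivative of `d`: the boundary terms vanish because the
primitive of `d'` in the statement is zero at both ends. -/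
theorem inner_volterra_eq_neg {d d' p : L2} {κ : ℂ} (hd' : inner ℂ one d' = 0)
    (hd : d = κ • one + volterra p) : inner ℂ (volterra d') p = -inner ℂ d' d := by
  have h := inner_volterra_add d' p
  have h0 : inner ℂ d' one = 0 := by rw [← inner_conj_symm, hd', map_zero]
  rw [h0, zero_mul] at h
  rw [hd, inner_add_right, inner_smul_right, h0]
  linear_combination h

/-- Both sides equal the symmetric form `⟨d, d'⟩ + ⟨f, Q f'⟩`, where `d`, `d'` are the derivatives
of `f`, `f'`. -/
theorem IsDirichletSL.inner_symm {q : ℝ → ℝ} {Q : LInf} (hQ : Q =ᵐ[mu] q) {f g f' g' : L2}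
    (h : IsDirichletSL q f g) (h' : IsDirichletSL q f' g') : inner ℂ g f' = inner ℂ f g' := by
  obtain ⟨d, κ, rfl, hd1, hd⟩ := (isDirichletSL_iff hQ _ _).1 h
  obtain ⟨d', κ', rfl, hd1', hd'⟩ := (isDirichletSL_iff hQ _ _).1 h'
  have e1 := congrArg (starRingEnd ℂ) (inner_volterra_eq_neg hd1' hd)
  have e2 := inner_volterra_eq_neg hd1 hd'
  rw [map_neg, inner_conj_symm, inner_conj_symm, inner_sub_left, inner_mulOp_comm] at e1
  rw [inner_sub_right] at e2
  linear_combination e2 - e1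

theorem volterra_relations_sum (Q : LInf) {ι : Type*} (s : Finset ι)
    (c : ι → ℂ) {f g : ι → L2} {d : ι → L2} {κ : ι → ℂ}
    (hf : ∀ i, f i = volterra (d i)) (h1 : ∀ i, inner ℂ one (d i) = 0)
    (hd : ∀ i, d i = κ i • one + volterra (mulOp Q (f i) - g i)) :
    ∑ i ∈ s, c i • f i = volterra (∑ i ∈ s, c i • d i) ∧ inner ℂ one (∑ i ∈ s, c i • d i) = 0 ∧
      ∑ i ∈ s, c i • d i = (∑ i ∈ s, c i * κ i) • one +
        volterra (mulOp Q (∑ i ∈ s, c i • f i) - ∑ i ∈ s, c i • g i) := by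
  refine ⟨?_, ?_, ?_⟩
  · simp only [map_sum, map_smul, hf]
  · simp [inner_sum, inner_smul_right, h1]
  · simp only [map_sub, map_sum, map_smul, Finset.sum_smul]
    rw [← Finset.sum_sub_distrib, ← Finset.sum_add_distrib]
    refine Finset.sum_congr rfl fun i _ => ?_
    conv_lhs => rw [hd i]
    rw [smul_add, map_sub, smul_sub, mul_smul]

/-- Agmon's inequality. -/
theorem norm_primitive_sq_le (d : L2) (x : Icc (0 : ℝ) 1) :
    ‖primitive d x‖ ^ 2 ≤ 2 * (‖d‖ * ‖volterra d‖) := by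
  -- Cutting `d` off beyond `x` makes its total integral equal to the primitive at `x`. Integration
  -- by parts of the truncation `e` with itself then gives `|∫₀ˣ d|² = 2 Re⟨e, V e⟩`, and `V e` may
  -- be replaced by `V d` on the support of `e`.
  have hm := (Lp.memLp d).indicator (measurableSet_Ioc (a := (0 : ℝ)) (b := x))
  set e : L2 := hm.toLp _ with he
  have hea : e =ᵐ[mu] (Ioc (0 : ℝ) x).indicator d := hm.coeFn_toLp
  have hle : ‖e‖ ≤ ‖d‖ := by
    refine Lp.norm_le_norm_of_ae_le ?_
    filter_upwards [hea] with t ht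
    rw [ht]
    exact norm_indicator_le_norm_self _ _
  have h1 : inner ℂ one e = primitive d x := by
    rw [inner_one, integral_congr_ae hea, integral_indicator measurableSet_Ioc,
      ← intervalIntegral_eq_setIntegral_mu le_rfl x.2.1 x.2.2, primitive_apply]
  have h2 : inner ℂ e (volterra e) = inner ℂ e (volterra d) := by
    rw [L2.inner_def, L2.inner_def]
    refine integral_congr_ae ?_
    filter_upwards [hea, coeFn_volterra e, coeFn_volterra d, ae_restrict_mem measurableSet_Ioo]
      with t h1 h2 h3 ht
    by_cases htx : t ≤ x
    · rw [h2, h3]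
      congr 1
      rw [integral_congr_ae_mu hea le_rfl ht.1.le ht.2.le]
      refine intervalIntegral.integral_congr_ae (Eventually.of_forall fun r hr => ?_)
      rw [uIoc_of_le ht.1.le] at hr
      exact indicator_of_mem (show r ∈ Ioc (0 : ℝ) x from ⟨hr.1, hr.2.trans htx⟩) _
    · rw [h1, indicator_of_notMem (fun h => htx h.2)]
      simp
  have h3 := inner_volterra_add e e
  rw [h1, ← inner_conj_symm (volterra e) e, ← inner_conj_symm e one, h1, h2] at h3
  have h4 := congrArg norm h3
  rw [norm_mul, RCLike.norm_conj, ← sq] at h4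
  rw [← h4]
  refine (norm_add_le _ _).trans ?_
  rw [RCLike.norm_conj, ← two_mul]
  gcongr
  refine (norm_inner_le_norm _ _).trans ?_
  gcongr

/-! ### The resolvent -/

/-- `R` inverts `𝓛 + c`. With `P` the projection off the constants, `J = VP` and its adjoint `J' =
-PV`, the equation for the derivative `d` reads `(1 + J' m J) d = J' g`, where `m = Q + c ≥ 0`. The
operator on the left is symmetric and bounded below by `1`, hence invertible; so `R = J N⁻¹ J'` is
symmetric, and compact because `V` is. -/
theorem exists_resolvent {q : ℝ → ℝ} {Q : LInf} (hQ : Q =ᵐ[mu] q) {c : ℝ}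
    (hc : ∀ᵐ x ∂mu, 0 ≤ Q x + c) :
    ∃ R : L2 →L[ℂ] L2, IsCompactOperator R ∧ R.IsSymmetric ∧ Function.Injective R ∧
      ∀ g, IsDirichletSL q (R g) (g - (c : ℂ) • R g) := by
  let m : L2 →L[ℂ] L2 := mulOp Q + (c : ℂ) • ContinuousLinearMap.id ℂ L2
  have hmsymm : ∀ f g, inner ℂ (m f) g = inner ℂ f (m g) := fun f g => by
    simp only [m, add_apply, smul_apply,
      ContinuousLinearMap.id_apply, inner_add_left, inner_add_right, inner_mulOp_comm,
      inner_smul_left, inner_smul_right, Complex.conj_ofReal]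
  have hmpos : ∀ f, 0 ≤ (inner ℂ f (m f)).re := fun f => by
    have hQc : MemLp (fun x => Q x + c) ∞ mu := (Lp.memLp Q).add (memLp_const c)
    have : m f = mulOp hQc.toLp f := by
      refine Lp.ext ?_
      filter_upwards [coeFn_mulOp hQc.toLp f, coeFn_mulOp Q f, hQc.coeFn_toLp,
        Lp.coeFn_add (mulOp Q f) ((c : ℂ) • f), Lp.coeFn_smul (c : ℂ) f] with x h1 h2 h3 h4 h5
      rw [h1, h3]
      refine h4.trans ?_
      rw [Pi.add_apply, h2, h5]
      simp [add_mul]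
    rw [this]
    refine re_inner_mulOp_nonneg ?_ f
    filter_upwards [hc, hQc.coeFn_toLp] with x h1 h2
    rwa [h2]
  let P : L2 →L[ℂ] L2 := ContinuousLinearMap.id ℂ L2 - (innerSL ℂ one).smulRight one
  have hP : ∀ f, P f = f - inner ℂ one f • one := fun f => rfl
  have hPsymm : ∀ f g, inner ℂ (P f) g = inner ℂ f (P g) := fun f g => by
    simp only [hP, inner_sub_left, inner_sub_right, inner_smul_left, inner_smul_right,
      inner_conj_symm]
    ring
  have hP1 : P one = 0 := by rw [hP, inner_one_one, one_smul, sub_self]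
  have hPo : ∀ f, inner ℂ one (P f) = 0 := fun f => by
    rw [hP, inner_sub_right, inner_smul_right, inner_one_one, mul_one, sub_self]
  have hPP : ∀ f, P (P f) = P f := fun f => by
    rw [hP (P f), hPo, zero_smul, sub_zero]
  let J : L2 →L[ℂ] L2 := volterra.comp P
  let J' : L2 →L[ℂ] L2 := -(P.comp volterra)
  have hJ : ∀ f g, inner ℂ (J f) g = inner ℂ f (J' g) := fun f g => by
    have h := inner_volterra_add (P f) g
    rw [← inner_conj_symm (P f) one, hPo, map_zero, zero_mul] at h
    change inner ℂ (volterra (P f)) g = inner ℂ f (-(P (volterra g)))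
    rw [inner_neg_right, ← hPsymm]
    linear_combination h
  have hJ' : ∀ f g, inner ℂ (J' f) g = inner ℂ f (J g) := fun f g => by
    rw [← inner_conj_symm, ← hJ, inner_conj_symm]
  let N : L2 →L[ℂ] L2 := 1 + J'.comp (m.comp J)
  have hN : ∀ f, N f = f + J' (m (J f)) := fun f => rfl
  have hNsymm : ∀ f g, inner ℂ (N f) g = inner ℂ f (N g) := fun f g => by
    rw [hN, hN, inner_add_left, inner_add_right, hJ', hmsymm, hJ]
  have hNu : IsUnit N := by
    refine ContinuousLinearMap.isUnit_of_forall_le_norm_inner_map N (c := 1) one_pos fun f => ?_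
    have h1 : (inner ℂ (N f) f).re = ‖f‖ ^ 2 + (inner ℂ (J f) (m (J f))).re := by
      rw [hNsymm, hN, inner_add_right, ← hJ, Complex.add_re, inner_self_eq_norm_sq_to_K]
      norm_cast
    have h2 := Complex.re_le_norm (inner ℂ (N f) f)
    have h3 := hmpos (J f)
    simp only [NNReal.coe_one]
    linarith
  obtain ⟨u, hu⟩ := hNu
  let N' : L2 →L[ℂ] L2 := ((u⁻¹ : (L2 →L[ℂ] L2)ˣ) : L2 →L[ℂ] L2)
  have hNN' : ∀ f, N (N' f) = f := fun f => by
    rw [← hu]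
    exact congrArg (fun A : L2 →L[ℂ] L2 => A f) u.mul_inv
  have hN'symm : ∀ f g, inner ℂ (N' f) g = inner ℂ f (N' g) := fun f g => by
    conv_lhs => rw [← hNN' g]
    rw [← hNsymm, hNN']
  let R : L2 →L[ℂ] L2 := J.comp (N'.comp J')
  have key : ∀ g, ∃ d κ, R g = volterra d ∧ inner ℂ one d = 0 ∧
      d = κ • one + volterra (m (R g) - g) := fun g => by
    have h1 : N' (J' g) = P (volterra (m (R g) - g)) := by
      have h2 : N' (J' g) + -(P (volterra (m (R g)))) = -(P (volterra g)) := hNN' (J' g)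
      rw [map_sub, map_sub]
      rw [← sub_eq_add_neg, sub_eq_iff_eq_add] at h2
      rw [h2]; abel
    -- The constant is the mean that `P` removes from `V(m R g - g)`.
    refine ⟨N' (J' g), -inner ℂ one (volterra (m (R g) - g)), ?_, ?_, ?_⟩
    · change volterra (P (N' (J' g))) = _
      rw [h1, hPP]
    · rw [h1, hPo]
    · conv_lhs => rw [h1, hP]
      rw [neg_smul]; abel
  refine ⟨R, ?_, ?_, ?_, fun g => ?_⟩
  · exact isCompactOperator_volterra.comp_clm (P.comp (N'.comp J'))
  · intro f g
    change inner ℂ (J (N' (J' f))) g = inner ℂ f (J (N' (J' g)))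
    rw [hJ, hN'symm, hJ']
  · rw [injective_iff_map_eq_zero]
    intro g hg
    obtain ⟨d, κ, h1, h2, h3⟩ := key g
    rw [hg] at h1 h3
    have hd : d = 0 := volterra_injective (by rw [← h1, map_zero])
    rw [hd, map_zero, zero_sub] at h3
    have h4 : (κ • 1 + primitive (-g) : BoundedContinuousFunction (Icc (0 : ℝ) 1) ℂ) = 0 :=
      toL2_injective (by rw [map_add, map_smul, map_zero]; exact h3.symm)
    have h5 := DFunLike.congr_fun h4 ⟨0, le_rfl, zero_le_one⟩
    simp only [BoundedContinuousFunction.add_apply, primitive_zero] at h5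
    have hκ : κ = 0 := by simpa using h5
    rw [hκ, zero_smul, zero_add] at h3
    have := volterra_injective (h3.symm.trans (map_zero _).symm)
    exact neg_eq_zero.1 this
  · refine (isDirichletSL_iff hQ _ _).2 ?_
    obtain ⟨d, κ, h1, h2, h3⟩ := key g
    refine ⟨d, κ, h1, h2, ?_⟩
    rw [h3]
    congr 2
    change mulOp Q (R g) + (c : ℂ) • R g - g = _
    abel

/-! ### The eigenbasis -/

theorem hasSum_of_forall_eq {α E : Type*} [AddCommMonoid E] [TopologicalSpace E] {f g : α → E}
    {a : E} (hg : HasSum g a) (h : ∀ i, f i = g i) : HasSum f a := by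
  rwa [funext h]

theorem IsDirichletSL.smul {q : ℝ → ℝ} {Q : LInf} (hQ : Q =ᵐ[mu] q) {f g : L2} (c : ℂ)
    (h : IsDirichletSL q f g) : IsDirichletSL q (c • f) (c • g) := by
  obtain ⟨d, κ, h1, h2, h3⟩ := (isDirichletSL_iff hQ _ _).1 h
  refine (isDirichletSL_iff hQ _ _).2 ⟨c • d, c * κ, by rw [h1, map_smul], ?_, ?_⟩
  · rw [inner_smul_right, h2, mul_zero]
  · conv_lhs => rw [h3]
    rw [smul_add, ← map_smul, smul_sub, ← map_smul (mulOp Q), mul_smul]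

/-- A compact symmetric operator has a Hilbert basis of eigenvectors. -/
theorem exists_hilbertBasis_eigenvectors {H : Type} [NormedAddCommGroup H] [InnerProductSpace ℂ H]
    [CompleteSpace H] {R : H →L[ℂ] H} (hR : IsCompactOperator R) (hR' : R.IsSymmetric) :
    ∃ (ι : Type) (b : HilbertBasis ι ℂ H) (μ : ι → ℂ), ∀ i, R (b i) = μ i • b i := by
  have hclosed : ∀ μ : ℂ, IsClosed (Module.End.eigenspace (R : Module.End ℂ H) μ : Set H) := fun μ => by
    have : (Module.End.eigenspace (R : Module.End ℂ H) μ : Set H) = {x | R x = μ • x} := by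
      ext x; exact Module.End.mem_eigenspace_iff
    rw [this]
    exact isClosed_eq R.continuous (continuous_const_smul μ)
  have : ∀ μ : ℂ, CompleteSpace (Module.End.eigenspace (R : Module.End ℂ H) μ) := fun μ =>
    (hclosed μ).completeSpace_coe
  choose w b _ using fun μ : ℂ =>
    exists_hilbertBasis ℂ (Module.End.eigenspace (R : Module.End ℂ H) μ)
  have hon : Orthonormal ℂ fun a : Σ μ : ℂ, w μ => ((b a.1 a.2 : _) : H) :=
    hR'.orthogonalFamily_eigenspaces.orthonormal_sigma_orthonormal fun μ => (b μ).orthonormal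
  have hbot : (Submodule.span ℂ (Set.range fun a : Σ μ : ℂ, w μ => ((b a.1 a.2 : _) : H)))ᗮ = ⊥ := by
    rw [← ContinuousLinearMap.orthogonalComplement_iSup_eigenspaces_eq_bot hR hR']
    refine le_antisymm ?_ ?_
    · rw [← Submodule.iInf_orthogonal]
      refine le_iInf fun μ x hx => ?_
      rw [Submodule.mem_orthogonal] at hx ⊢
      intro y hy
      have h0 : (Module.End.eigenspace (R : Module.End ℂ H) μ).orthogonalProjectionOnto x = 0 :=
        ext_coeff (b μ) fun i => by
          rw [Submodule.inner_orthogonalProjectionOnto_eq_of_mem_left, inner_zero_right]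
          exact hx _ (Submodule.subset_span ⟨⟨μ, i⟩, rfl⟩)
      rw [Submodule.orthogonalProjectionOnto_eq_zero_iff] at h0
      exact (Submodule.mem_orthogonal _ _).1 h0 y hy
    · refine Submodule.orthogonal_le (Submodule.span_le.2 ?_)
      rintro _ ⟨a, rfl⟩
      exact (le_iSup (Module.End.eigenspace (R : Module.End ℂ H)) a.1) (b a.1 a.2).2
  refine ⟨_, HilbertBasis.mkOfOrthogonalEqBot hon hbot, fun a => a.1, fun a => ?_⟩
  rw [HilbertBasis.coe_mkOfOrthogonalEqBot]
  exact Module.End.mem_eigenspace_iff.1 (b a.1 a.2).2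

theorem exists_eigenbasis {q : ℝ → ℝ} {Q : LInf} (hQ : Q =ᵐ[mu] q) :
    ∃ (ι : Type) (b : HilbertBasis ι ℂ L2) (lam : ι → ℝ),
      ∀ i, IsDirichletSL q (b i) ((lam i : ℂ) • b i) := by
  have hc : ∀ᵐ x ∂mu, 0 ≤ Q x + ‖Q‖ := by
    filter_upwards [enorm_ae_le_eLpNormEssSup Q mu] with x hx
    rw [← eLpNorm_exponent_top, ← Lp.enorm_def, enorm_le_iff_norm_le] at hx
    linarith [neg_abs_le (Q x), Real.norm_eq_abs (Q x)]
  obtain ⟨R, hR, hRs, hRi, hRq⟩ := exists_resolvent hQ hc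
  obtain ⟨ι, b, μ, hμ⟩ := exists_hilbertBasis_eigenvectors hR hRs
  have hb0 : ∀ i, b i ≠ 0 := fun i => b.orthonormal.ne_zero i
  -- The shift is `c = ‖Q‖`, so an eigenvalue `μ` of `R` corresponds to `μ⁻¹ - ‖Q‖`. It is nonzero
  -- since `R` is injective and real since `R` is symmetric.
  refine ⟨ι, b, fun i => ((μ i).re)⁻¹ - ‖Q‖, fun i => ?_⟩
  have hμ0 : μ i ≠ 0 := fun h => hb0 i (hRi (by rw [hμ, h, zero_smul, map_zero]))
  have hμr : ((μ i).re : ℂ) = μ i := Complex.conj_eq_iff_re.1 (hRs.conj_eigenvalue_eq_self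
    (Module.End.hasEigenvalue_of_hasEigenvector
      ⟨Module.End.mem_eigenspace_iff.2 (hμ i), hb0 i⟩))
  have h := (hRq (b i)).smul hQ (μ i)⁻¹
  rw [hμ, smul_smul, inv_mul_cancel₀ hμ0, one_smul] at h
  convert h using 1
  push_cast
  rw [hμr, smul_sub, smul_smul, smul_smul, sub_smul]
  congr 2
  field_simp

/-! ### Fractional powers, spectral gap and boundary values -/

section Spectral

variable {q : ℝ → ℝ} {Q : LInf} {ι : Type} {b : HilbertBasis ι ℂ L2} {lam : ι → ℝ}

/-- An arbitrary eigenvector is orthogonal to every `b i` with a different eigenvalue. The relations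
along the basis therefore imply, by Parseval, those along all eigenvectors. -/
theorem isFracPow_iff (hQ : Q =ᵐ[mu] q) (hb : ∀ i, IsDirichletSL q (b i) ((lam i : ℂ) • b i))
    {r : ℝ} {f g : L2} : IsFracPow q r f g ↔
      ∀ i, inner ℂ (b i) g = ((lam i ^ r : ℝ) : ℂ) * inner ℂ (b i) f := by
  refine ⟨fun h i => h (lam i) (b i) ⟨b.orthonormal.ne_zero i, hb i⟩, fun h l φ hφ => ?_⟩
  refine (b.hasSum_inner_mul_inner φ g).unique ?_
  refine hasSum_of_forall_eq ((b.hasSum_inner_mul_inner φ f).mul_left ((l ^ r : ℝ) : ℂ))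
    fun i => ?_
  rw [h i]
  have hs := hφ.2.inner_symm hQ (hb i)
  rw [inner_smul_left, inner_smul_right, Complex.conj_ofReal] at hs
  by_cases hl : l = lam i
  · rw [hl]; ring
  · have : inner ℂ φ (b i) = 0 := by
      have h1 : ((l : ℂ) - lam i) * inner ℂ φ (b i) = 0 := by linear_combination hs
      refine (mul_eq_zero.1 h1).resolve_left ?_
      exact fun h => hl (by exact_mod_cast sub_eq_zero.1 h)
    rw [this]; ring

/-- The continuous representatives of eigenfunctions; the sup norm of a linear combination of
eigenfunctions with eigenvalues at most `Λ` is `O(Λ^{1/4})` times its `L²` norm. -/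
theorem exists_continuous_eigenfunctions (hQ : Q =ᵐ[mu] q)
    (hb : ∀ i, IsDirichletSL q (b i) ((lam i : ℂ) • b i)) :
    ∃ e : ι → BoundedContinuousFunction (Icc (0 : ℝ) 1) ℂ, (∀ i, toL2 (e i) = b i) ∧
      (∀ i, e i ⟨0, le_rfl, zero_le_one⟩ = 0) ∧ (∀ i, e i ⟨1, zero_le_one, le_rfl⟩ = 0) ∧
      ∀ (s : Finset ι) (Λ : ℝ), 0 ≤ Λ → (∀ i ∈ s, lam i ≤ Λ) → ∀ (a : ι → ℂ) (x : Icc (0 : ℝ) 1),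
        ‖∑ i ∈ s, a i * e i x‖ ^ 2 ≤ 2 * √(Λ + ‖Q‖) * ∑ i ∈ s, ‖a i‖ ^ 2 := by
  choose d κ h1 h2 h3 using fun i => (isDirichletSL_iff hQ _ _).1 (hb i)
  refine ⟨fun i => primitive (d i), fun i => (h1 i).symm, fun i => primitive_zero _, fun i => by
    rw [primitive_one_eq_inner, h2], fun s Λ hΛ hs a x => ?_⟩
  obtain ⟨H1, H2, H3⟩ := volterra_relations_sum Q s a h1 h2 h3
  set f : L2 := ∑ i ∈ s, a i • b i with hf
  set D : L2 := ∑ i ∈ s, a i • d i with hD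
  set g : L2 := ∑ i ∈ s, a i • (lam i : ℂ) • b i with hg
  have hx : ∑ i ∈ s, a i * primitive (d i) x = primitive D x := by
    rw [hD, map_sum]
    simp only [map_smul]
    rw [BoundedContinuousFunction.sum_apply]
    simp
  have hff : ‖f‖ ^ 2 = ∑ i ∈ s, ‖a i‖ ^ 2 := by
    have h := b.orthonormal.inner_sum a a s
    rw [← hf, inner_self_eq_norm_sq_to_K] at h
    have h' : ((‖f‖ ^ 2 : ℝ) : ℂ) = ((∑ i ∈ s, ‖a i‖ ^ 2 : ℝ) : ℂ) := by
      push_cast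
      refine h.trans (Finset.sum_congr rfl fun i _ => ?_)
      rw [RCLike.conj_mul]; rfl
    exact_mod_cast h'
  have hfg : (inner ℂ f g).re ≤ Λ * ‖f‖ ^ 2 := by
    have h := b.orthonormal.inner_sum a (fun i => a i * (lam i : ℂ)) s
    simp only [mul_smul] at h
    rw [← hf, ← hg] at h
    rw [h, hff, Finset.mul_sum, Complex.re_sum]
    refine Finset.sum_le_sum fun i hi => ?_
    rw [← mul_assoc, RCLike.conj_mul]
    change (((‖a i‖ : ℝ) : ℂ) ^ 2 * (lam i : ℂ)).re ≤ _
    rw [← Complex.ofReal_pow, ← Complex.ofReal_mul, Complex.ofReal_re, mul_comm]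
    have := hs i hi
    gcongr
  -- Energy identity `‖f'‖² = ⟨f, 𝓛f⟩ - ⟨f, Qf⟩`; Agmon's inequality turns it into the sup bound.
  have hDn : ‖D‖ ^ 2 ≤ (Λ + ‖Q‖) * ‖f‖ ^ 2 := by
    have h := congrArg Complex.re (inner_volterra_eq_neg H2 H3)
    rw [← H1, inner_sub_right, inner_self_eq_norm_sq_to_K, Complex.sub_re, Complex.neg_re] at h
    have h' : (((‖D‖ : ℝ) : ℂ) ^ 2).re = ‖D‖ ^ 2 := by
      rw [← Complex.ofReal_pow, Complex.ofReal_re]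
    have h5 : -(inner ℂ f (mulOp Q f)).re ≤ ‖Q‖ * ‖f‖ ^ 2 := by
      refine (neg_le_abs _).trans ((Complex.abs_re_le_norm _).trans
        ((norm_inner_le_norm _ _).trans ?_))
      have := (mulOp Q).le_of_opNorm_le (norm_mulOp_le Q) f
      nlinarith [norm_nonneg f]
    have h6 : (inner ℂ f (mulOp Q f)).re - (inner ℂ f g).re = -‖D‖ ^ 2 := by
      rw [← h']; exact h
    linarith
  rw [hx, ← hff]
  refine (norm_primitive_sq_le D x).trans ?_
  rw [← H1]
  have h7 : ‖D‖ ≤ √(Λ + ‖Q‖) * ‖f‖ := by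
    refine le_of_sq_le_sq ?_ (by positivity)
    rwa [mul_pow, Real.sq_sqrt (by positivity)]
  nlinarith [norm_nonneg f, mul_le_mul_of_nonneg_right h7 (norm_nonneg f)]

theorem norm_toL2_sq (f : BoundedContinuousFunction (Icc (0 : ℝ) 1) ℂ) :
    Integrable (fun x => ‖f (projIcc 0 1 zero_le_one x)‖ ^ 2) mu ∧
      ‖toL2 f‖ ^ 2 = ∫ x, ‖f (projIcc 0 1 zero_le_one x)‖ ^ 2 ∂mu := by
  have h1 : (fun x => ‖toL2 f x‖ ^ 2) =ᵐ[mu] fun x => ‖f (projIcc 0 1 zero_le_one x)‖ ^ 2 := by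
    filter_upwards [coeFn_toL2 f] with x hx
    rw [hx]
  refine ⟨((Lp.memLp (toL2 f)).integrable_norm_pow two_ne_zero).congr h1, ?_⟩
  have h2 : ((‖toL2 f‖ ^ 2 : ℝ) : ℂ) = ((∫ x, ‖toL2 f x‖ ^ 2 ∂mu : ℝ) : ℂ) := by
    rw [← integral_complex_ofReal]
    have h3 := inner_self_eq_norm_sq_to_K (𝕜 := ℂ) (toL2 f)
    push_cast
    refine h3.symm.trans ?_
    rw [L2.inner_def]
    refine integral_congr_ae (Eventually.of_forall fun x => ?_)
    exact inner_self_eq_norm_sq_to_K (𝕜 := ℂ) (toL2 f x)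
  rw [← integral_congr_ae h1]
  exact_mod_cast h2

/-- Taking `a i` to be the conjugate of `e i x` in the sup bound gives `∑ |e i x|² ≤ M` at every
`x`. Integration over the unit interval turns the left side into the number of eigenfunctions. -/
theorem finite_setOf_eigenvalue_le (hQ : Q =ᵐ[mu] q)
    (hb : ∀ i, IsDirichletSL q (b i) ((lam i : ℂ) • b i)) (Λ : ℝ) : {i | lam i ≤ Λ}.Finite := by
  obtain ⟨e, he, -, -, hbound⟩ := exists_continuous_eigenfunctions hQ hb
  set M : ℝ := 2 * √(|Λ| + ‖Q‖)
  have hM : 0 ≤ M := by positivity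
  have hcard : ∀ s : Finset ι, (∀ i ∈ s, lam i ≤ Λ) → (s.card : ℝ) ≤ M := fun s hs => by
    have hx : ∀ x : Icc (0 : ℝ) 1, ∑ i ∈ s, ‖e i x‖ ^ 2 ≤ M := fun x => by
      have h := hbound s |Λ| (abs_nonneg _) (fun i hi => (hs i hi).trans (le_abs_self _))
        (fun i => (starRingEnd ℂ) (e i x)) x
      have h1 : ∑ i ∈ s, (starRingEnd ℂ) (e i x) * e i x = ((∑ i ∈ s, ‖e i x‖ ^ 2 : ℝ) : ℂ) := by
        push_cast
        exact Finset.sum_congr rfl fun i _ => RCLike.conj_mul _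
      have h0 : 0 ≤ ∑ i ∈ s, ‖e i x‖ ^ 2 := by positivity
      simp only [h1, RCLike.norm_conj, Complex.norm_real, Real.norm_of_nonneg h0] at h
      by_contra! hlt
      nlinarith
    have h1 : (s.card : ℝ) = ∫ x, ∑ i ∈ s, ‖e i (projIcc 0 1 zero_le_one x)‖ ^ 2 ∂mu := by
      rw [integral_finsetSum _ fun i _ => (norm_toL2_sq (e i)).1]
      simp_rw [← (norm_toL2_sq _).2, he, b.orthonormal.1]
      simp
    rw [h1]
    refine (integral_mono (integrable_finsetSum _ fun i _ => (norm_toL2_sq (e i)).1)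
      (integrable_const M) fun x => hx _).trans ?_
    simp
  by_contra hinf
  obtain ⟨t, ht, htc⟩ := Set.Infinite.exists_subset_card_eq hinf (⌊M⌋₊ + 1)
  have := hcard t fun i hi => ht hi
  rw [htc] at this
  push_cast at this
  linarith [Nat.lt_floor_add_one M]

theorem exists_pos_le_eigenvalue (hQ : Q =ᵐ[mu] q)
    (hb : ∀ i, IsDirichletSL q (b i) ((lam i : ℂ) • b i)) (hpos : ∀ i, 0 < lam i) :
    ∃ δ > 0, ∀ i, δ ≤ lam i := by
  have hfin := finite_setOf_eigenvalue_le hQ hb 1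
  rcases {i | lam i ≤ 1}.eq_empty_or_nonempty with h | h
  · refine ⟨1, one_pos, fun i => ?_⟩
    by_contra! hi
    exact (h ▸ (show i ∈ {i | lam i ≤ 1} from hi.le) : i ∈ (∅ : Set ι))
  · obtain ⟨i₀, hi₀, hmin⟩ := Set.exists_min_image _ lam hfin h
    refine ⟨lam i₀, hpos i₀, fun i => ?_⟩
    by_cases hi : lam i ≤ 1
    · exact hmin i hi
    · exact le_trans hi₀ (not_le.1 hi).le

/-- Split `u` into dyadic blocks of eigenvalues of size about `2^j`. A block has `L²` norm
`O(2^{-js/2})` and loses `2^{j/4}` on passing to the sup norm, so for `s > 1/2` the blocks sum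
geometrically to a uniform limit of functions vanishing at both ends. -/
theorem vanishesAtEndpoints_of_coeff (hQ : Q =ᵐ[mu] q)
    (hb : ∀ i, IsDirichletSL q (b i) ((lam i : ℂ) • b i)) {δ : ℝ} (hδ : 0 < δ)
    (hlam : ∀ i, δ ≤ lam i) {s : ℝ} (hs : 1 / 2 < s) {u w : L2}
    (huw : ∀ i, inner ℂ (b i) w = ((lam i ^ (s / 2) : ℝ) : ℂ) * inner ℂ (b i) u) :
    VanishesAtEndpoints u := by
  classical
  obtain ⟨e, he, he0, he1, hbound⟩ := exists_continuous_eigenfunctions hQ hb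
  let ℓ : ι → ℕ := fun i => Nat.clog 2 ⌈lam i⌉₊
  have hℓ1 : ∀ i, lam i ≤ 2 ^ ℓ i := fun i => (Nat.le_ceil _).trans (by
    exact_mod_cast Nat.le_pow_clog one_lt_two _)
  -- Above the bottom block `lam i > 2^{ℓ i} / 2`; in the bottom block, which contains all
  -- eigenvalues in `(0,1]`, only `lam i ≥ δ` is available.
  set η : ℝ := min δ (1 / 2) with hη
  have hη0 : 0 < η := by positivity
  have hℓ2 : ∀ i, η * 2 ^ ℓ i ≤ lam i := fun i => by
    rcases Nat.eq_zero_or_pos (ℓ i) with h | h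
    · rw [h, pow_zero, mul_one]
      exact (min_le_left _ _).trans (hlam i)
    · have h1 : 2 ^ (ℓ i - 1) < ⌈lam i⌉₊ := by
        by_contra! hle
        have := Nat.clog_le_of_le_pow hle
        simp only [ℓ] at this h
        omega
      have h2 : ((2 ^ (ℓ i - 1) : ℕ) : ℝ) < lam i := Nat.lt_ceil.1 h1
      have h3 : (2 : ℝ) ^ ℓ i = 2 * 2 ^ (ℓ i - 1) := by
        rw [← pow_succ', Nat.sub_add_cancel h]
      push_cast at h2
      rw [h3]
      have : η ≤ 1 / 2 := min_le_right _ _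
      have h4 : (0 : ℝ) < 2 ^ (ℓ i - 1) := by positivity
      nlinarith
  let S : ℕ → Finset ι := fun j =>
    (finite_setOf_eigenvalue_le hQ hb (2 ^ j)).toFinset.filter fun i => ℓ i = j
  have hS : ∀ i j, i ∈ S j ↔ ℓ i = j := fun i j => by
    simp only [S, Finset.mem_filter, Set.Finite.mem_toFinset, mem_ofPred_eq, and_iff_right_iff_imp]
    rintro rfl
    exact hℓ1 i
  let F : ℕ → BoundedContinuousFunction (Icc (0 : ℝ) 1) ℂ := fun j =>
    ∑ i ∈ S j, inner ℂ (b i) u • e i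
  have hFx : ∀ j x, F j x = ∑ i ∈ S j, inner ℂ (b i) u * e i x := fun j x => by
    simp [F, BoundedContinuousFunction.sum_apply]
  -- `ρ = 2^{1/2-s}` is the geometric ratio of the bounds for the squared sup norms of the blocks.
  set ρ : ℝ := 2 ^ (-s) * √2 with hρ
  have hρ0 : 0 ≤ ρ := by positivity
  have hρ1 : ρ < 1 := by
    rw [hρ, Real.sqrt_eq_rpow, ← Real.rpow_add two_pos]
    exact Real.rpow_lt_one_of_one_lt_of_neg one_lt_two (by linarith)
  set K : ℝ := 2 * √(1 + ‖Q‖) * (η ^ (-s) * ‖w‖ ^ 2) with hK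
  have hK0 : 0 ≤ K := by positivity
  have hcoef : ∀ j, ∑ i ∈ S j, ‖inner ℂ (b i) u‖ ^ 2 ≤ (2 ^ (-s)) ^ j * (η ^ (-s) * ‖w‖ ^ 2) :=
    fun j => by
      have hB : ∑ i ∈ S j, ‖inner ℂ (b i) w‖ ^ 2 ≤ ‖w‖ ^ 2 :=
        b.orthonormal.sum_inner_products_le w
      rw [← mul_assoc]
      refine le_trans ?_ (mul_le_mul_of_nonneg_left hB (by positivity))
      rw [Finset.mul_sum]
      refine Finset.sum_le_sum fun i hi => ?_
      rw [hS] at hi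
      have hl0 : 0 < lam i := hδ.trans_le (hlam i)
      have h1 : ‖inner ℂ (b i) w‖ ^ 2 = lam i ^ s * ‖inner ℂ (b i) u‖ ^ 2 := by
        rw [huw, norm_mul, mul_pow, Complex.norm_real, Real.norm_of_nonneg (by positivity),
          ← Real.rpow_natCast, ← Real.rpow_mul hl0.le]
        congr 2; push_cast; ring
      have h2 : ((2 : ℝ) ^ (-s)) ^ j * η ^ (-s) = (η * 2 ^ j) ^ (-s) := by
        rw [Real.mul_rpow hη0.le (by positivity), mul_comm, ← Real.rpow_natCast,
          ← Real.rpow_natCast, ← Real.rpow_mul two_pos.le, ← Real.rpow_mul two_pos.le, mul_comm (-s)]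
      have h3 : 1 ≤ (η * 2 ^ j) ^ (-s) * lam i ^ s := by
        have h4 : (η * 2 ^ j) ^ s ≤ lam i ^ s :=
          Real.rpow_le_rpow (by positivity) (hi ▸ hℓ2 i) (by linarith)
        rw [Real.rpow_neg (by positivity), ← div_eq_inv_mul, one_le_div (by positivity)]
        exact h4
      rw [h1, h2, ← mul_assoc]
      exact le_mul_of_one_le_left (by positivity) h3
  have hsqrt : ∀ j : ℕ, √((2 : ℝ) ^ j + ‖Q‖) ≤ √(1 + ‖Q‖) * √2 ^ j := fun j => by
    refine Real.sqrt_le_iff.2 ⟨by positivity, ?_⟩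
    rw [mul_pow, Real.sq_sqrt (by positivity), ← pow_mul, mul_comm j, pow_mul, Real.sq_sqrt two_pos.le]
    have : (1 : ℝ) ≤ 2 ^ j := one_le_pow₀ one_le_two
    nlinarith [norm_nonneg Q]
  have hFn : ∀ j, ‖F j‖ ≤ √K * √ρ ^ j := fun j => by
    refine (BoundedContinuousFunction.norm_le (by positivity)).2 fun x => ?_
    refine le_of_sq_le_sq ?_ (by positivity)
    rw [mul_pow, Real.sq_sqrt hK0, ← pow_mul, mul_comm j, pow_mul, Real.sq_sqrt hρ0, hFx]
    refine (hbound (S j) (2 ^ j) (by positivity)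
      (fun i hi => ((hS i j).1 hi) ▸ hℓ1 i) _ x).trans ?_
    calc 2 * √((2 : ℝ) ^ j + ‖Q‖) * ∑ i ∈ S j, ‖inner ℂ (b i) u‖ ^ 2
        ≤ 2 * (√(1 + ‖Q‖) * √2 ^ j) * ((2 ^ (-s)) ^ j * (η ^ (-s) * ‖w‖ ^ 2)) := by
          gcongr
          · exact hsqrt j
          · exact hcoef j
      _ = K * ρ ^ j := by rw [hK, hρ, mul_pow]; ring
  have hsum : Summable F := Summable.of_norm_bounded
    ((summable_geometric_of_lt_one (Real.sqrt_nonneg _) (by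
      rw [Real.sqrt_lt' one_pos]; simpa using hρ1)).mul_left _) hFn
  obtain ⟨G, hG⟩ := hsum
  have hGu : u = toL2 G := by
    refine ext_coeff b fun i => ?_
    have h1 := hG.mapL ((innerSL ℂ (b i)).comp toL2)
    refine (hasSum_ite_eq (ℓ i) (inner ℂ (b i) u)).unique (hasSum_of_forall_eq h1 fun j => ?_)
    simp only [F, ContinuousLinearMap.comp_apply, map_sum, map_smul, he, innerSL_apply_apply,
      orthonormal_iff_ite.1 b.orthonormal, smul_eq_mul, mul_ite, mul_one, mul_zero,
      Finset.sum_ite_eq, hS]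
    simp only [eq_comm]
  have hev : ∀ x, (∀ i, e i x = 0) → G x = 0 := fun x hx => by
    have h1 := hG.mapL (BoundedContinuousFunction.evalCLM ℂ x)
    refine h1.unique (hasSum_of_forall_eq hasSum_zero fun j => ?_)
    change F j x = 0
    rw [hFx]
    exact Finset.sum_eq_zero fun i _ => by rw [hx i, mul_zero]
  refine ⟨fun x => G (projIcc 0 1 zero_le_one x),
    (G.continuous.comp continuous_projIcc).continuousOn, ?_, ?_, ?_⟩
  · rw [hGu]; exact coeFn_toL2 G
  · simp only [projIcc_left]; exact hev _ he0
  · simp only [projIcc_right]; exact hev _ he1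

end Spectral

/-! ### Arithmetic of moderate nets -/

theorem inv_pow_le_inv_pow {ε : ℝ} (hε : ε ∈ Ioc (0 : ℝ) 1) {M N : ℕ} (h : M ≤ N) :
    (ε ^ M)⁻¹ ≤ (ε ^ N)⁻¹ :=
  inv_anti₀ (pow_pos hε.1 _) (pow_le_pow_of_le_one hε.1.le hε.2 h)

theorem IsModerate.add {m n : ℝ → ℝ} (hm : IsModerate m) (hn : IsModerate n) :
    IsModerate fun ε => m ε + n ε := by
  obtain ⟨M, C, hC, h⟩ := hm
  obtain ⟨N, D, hD, h'⟩ := hn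
  refine ⟨M + N, C + D, by positivity, fun ε hε => ?_⟩
  rw [add_mul]
  refine add_le_add ((h ε hε).trans ?_) ((h' ε hε).trans ?_)
  · exact mul_le_mul_of_nonneg_left (inv_pow_le_inv_pow hε (Nat.le_add_right _ _)) hC.le
  · exact mul_le_mul_of_nonneg_left (inv_pow_le_inv_pow hε (Nat.le_add_left _ _)) hD.le

theorem IsModerate.mul {m n : ℝ → ℝ} (hm : IsModerate m) (hn : IsModerate n)
    (hn0 : ∀ ε, 0 ≤ n ε) : IsModerate fun ε => m ε * n ε := by
  obtain ⟨M, C, hC, h⟩ := hm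
  obtain ⟨N, D, hD, h'⟩ := hn
  refine ⟨M + N, C * D, by positivity, fun ε hε => ?_⟩
  have := hε.1
  calc m ε * n ε ≤ (C * (ε ^ M)⁻¹) * (D * (ε ^ N)⁻¹) :=
        mul_le_mul (h ε hε) (h' ε hε) (hn0 ε) (by positivity)
    _ = C * D * (ε ^ (M + N))⁻¹ := by rw [pow_add, mul_inv]; ring

theorem isModerate_const {c : ℝ} (hc : 0 < c) : IsModerate fun _ => c :=
  ⟨0, c, hc, fun ε _ => by simp⟩

/-- Replaces the square root of the energy by an expression built from sums and products only, to
which the closure rules for moderate nets apply. -/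
theorem le_of_energy_le {w v w₀ u₁ a u₀ : ℝ} (hw₀ : 0 ≤ w₀) (hu₁ : 0 ≤ u₁)
    (ha : 0 ≤ a) (hu₀ : 0 ≤ u₀) (h : w ^ 2 + v ^ 2 ≤ w₀ ^ 2 + u₁ ^ 2 + a * u₀ ^ 2) :
    w ≤ w₀ + u₁ + (1 + a) * u₀ ∧ v ≤ w₀ + u₁ + (1 + a) * u₀ := by
  have hX : w₀ ^ 2 + u₁ ^ 2 + a * u₀ ^ 2 ≤ (w₀ + u₁ + (1 + a) * u₀) ^ 2 := by
    have h1 : 0 ≤ (1 + a) * u₀ := by positivity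
    have h2 : a * u₀ ^ 2 ≤ ((1 + a) * u₀) ^ 2 := by
      rw [mul_pow]
      gcongr
      nlinarith
    nlinarith [mul_nonneg hw₀ hu₁, mul_nonneg hw₀ h1, mul_nonneg hu₁ h1]
  constructor
  · exact le_of_sq_le_sq (by nlinarith [sq_nonneg v]) (by positivity)
  · exact le_of_sq_le_sq (by nlinarith [sq_nonneg w]) (by positivity)

end SturmLiouville

end

/-! ### The existence theorem -/

theorem mainTheorem5 (T : ℝ) (hT : 0 < T) (s : ℝ) (hs : 0 ≤ s)
    (q : ℝ → ℝ) (hq : MemLp q ∞ SturmLiouville.mu)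
    (hpos : ∀ (lam : ℝ) (phi : SturmLiouville.L2),
      SturmLiouville.IsEigenpair q lam phi → 0 < lam)
    (a b : 𝓓'(SturmLiouville.unitOpen, ℝ)) (u0 u1 : 𝓓'(SturmLiouville.unitOpen, ℂ))
    (ha : SturmLiouville.IsNonnegDistribution a) (hb : SturmLiouville.IsNonnegDistribution b)
    (aE bE : ℝ → SturmLiouville.LInf) (u0E u1E : ℝ → SturmLiouville.L2)
    (hreg : SturmLiouville.ModerateRegularisations q s a b u0 u1 aE bE u0E u1E) :
    ∃ u : ℝ → ℝ → SturmLiouville.L2,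
      SturmLiouville.IsModerateSolutionNet T q s aE bE u0E u1E u ∧
      SturmLiouville.IsVeryWeakSolution T q s a b u0 u1 u := by
  suffices h : ∃ u, SturmLiouville.IsModerateSolutionNet T q s aE bE u0E u1E u by
    obtain ⟨u, hu⟩ := h
    exact ⟨u, hu, aE, bE, u0E, u1E, hreg, hu⟩
  have hQ : hq.toLp q =ᵐ[SturmLiouville.mu] q := hq.coeFn_toLp
  obtain ⟨ι, e, lam, he⟩ := SturmLiouville.exists_eigenbasis hQ
  have hlam : ∀ i, 0 < lam i := fun i => hpos _ (e i) ⟨e.orthonormal.ne_zero i, he i⟩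
  obtain ⟨δ, hδ, hδl⟩ := SturmLiouville.exists_pos_le_eigenvalue hQ he hlam
  have hδ' : 0 < δ ^ (s / 2) := Real.rpow_pos_of_pos hδ _
  have hω : ∀ i, δ ^ (s / 2) ≤ lam i ^ (s / 2) := fun i =>
    Real.rpow_le_rpow hδ.le (hδl i) (by positivity)
  have hfrac := fun f g => SturmLiouville.isFracPow_iff hQ he (r := s / 2) (f := f) (g := g)
  -- A Poincaré inequality from the spectral gap: it bounds `u_ε` by `𝓛^{s/2} u_ε`, and the initial
  -- `L²` norm by the `W^s_𝓛` norm.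
  have hnorm : ∀ f g : SturmLiouville.L2, SturmLiouville.IsFracPow q (s / 2) f g →
      ‖f‖ ≤ (δ ^ (s / 2))⁻¹ * ‖g‖ := fun f g h => by
    refine SturmLiouville.norm_le_mul_of_coeff_le e (by positivity) fun i => ?_
    rw [(hfrac f g).1 h i, norm_mul, Complex.norm_real,
      Real.norm_of_nonneg (hδ'.le.trans (hω i)), ← mul_assoc]
    refine le_mul_of_one_le_left (norm_nonneg _) ?_
    rw [← div_eq_inv_mul, one_le_div hδ']
    exact hω i
  obtain ⟨g, hg, hgm⟩ := hreg.u0_moderate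
  have hsol : ∀ ε ∈ Ioc (0 : ℝ) 1, ∃ u v w : ℝ → SturmLiouville.L2, _ := fun ε hε =>
    SturmLiouville.exists_damped_wave e hδ' hω (SturmLiouville.mulOp (aE ε))
      (SturmLiouville.mulOp (bE ε)) (SturmLiouville.inner_mulOp_comm _)
      (SturmLiouville.re_inner_mulOp_nonneg ((Lp.coeFn_nonneg _).2 (hreg.a_nonneg ε hε)))
      (SturmLiouville.re_inner_mulOp_nonneg ((Lp.coeFn_nonneg _).2 (hreg.b_nonneg ε hε)))
      (u₁ := u1E ε) ((hfrac _ _).1 (hg ε hε)) hT.le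
  choose! u v w hu0 hv0 hvc hwc huw hud hweak hen using hsol
  have hspace : ∀ ε ∈ Ioc (0 : ℝ) 1,
      SturmLiouville.IsInSolutionSpace T q s (u ε) (v ε) (w ε) := fun ε hε =>
    ⟨hud ε hε, (hvc ε hε).continuousOn, fun t _ => (hfrac _ _).2 (huw ε hε t),
      (hwc ε hε).continuousOn⟩
  refine ⟨u, fun ε hε => ⟨v ε, w ε, hspace ε hε, fun f g hfg => hweak ε hε f g ((hfrac f g).1 hfg),
    hu0 ε hε, hv0 ε hε, fun hs2 t _ =>
      SturmLiouville.vanishesAtEndpoints_of_coeff hQ he hδ hδl hs2 (huw ε hε t)⟩, v, w, hspace, ?_⟩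
  -- The factor counts one bound each for `w` and `v`, plus `δ^{-s/2}` times that bound for `u`.
  have hX : SturmLiouville.IsModerate fun ε =>
      (2 + (δ ^ (s / 2))⁻¹) * (‖g ε‖ + ‖u1E ε‖ + (1 + ‖aE ε‖) * ((δ ^ (s / 2))⁻¹ * ‖g ε‖)) :=
    (SturmLiouville.isModerate_const (by positivity)).mul
      ((hgm.add hreg.u1_moderate).add
        (((SturmLiouville.isModerate_const one_pos).add hreg.a_moderate).mul
          ((SturmLiouville.isModerate_const (by positivity)).mul hgm fun _ => norm_nonneg _)
          fun _ => by positivity)) fun _ => by positivity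
  obtain ⟨N, C, hC, hNC⟩ := hX
  refine ⟨N, C, hC, fun ε hε t ht => le_trans ?_ (hNC ε hε)⟩
  have hE : ‖w ε t‖ ^ 2 + ‖v ε t‖ ^ 2 ≤ ‖g ε‖ ^ 2 + ‖u1E ε‖ ^ 2 +
      ‖aE ε‖ * ((δ ^ (s / 2))⁻¹ * ‖g ε‖) ^ 2 := by
    refine (hen ε hε t ht).trans ?_
    gcongr
    · exact SturmLiouville.norm_mulOp_le _
    · exact hnorm _ _ (hg ε hε)
  obtain ⟨h1, h2⟩ := SturmLiouville.le_of_energy_le (norm_nonneg _) (norm_nonneg _)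
    (norm_nonneg _) (by positivity) hE
  have h3 : ‖u ε t‖ ≤ (δ ^ (s / 2))⁻¹ * ‖w ε t‖ := hnorm _ _ ((hspace ε hε).frac t ht)
  have h4 := mul_le_mul_of_nonneg_left h1 (inv_nonneg.2 hδ'.le)
  linarith
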